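/- Let $B_r(x)=\{y\in\mathbb R^3:|x-y|<r\}$ and, for $z=(x,t)\in\mathbb R^3\times\mathbb R$, $Q_r(z)=B_r(x)\times(t-r^2,t)$. Let $\omega\subset\mathbb R^3$ be open and $-\infty<a<b<\infty$. A pair $(u,p)$ with $u:\omega\times(a,b)\to\mathbb R^3$, $p:\omega\times(a,b)\to\mathbb R$ is a *suitable weak solution* of the Navier–Stokes equations in $Q=\omega\times(a,b)$ if (i) $u\in L^\infty(a,b;L^2(\omega))\cap L^2(a,b;W^{1,2}(\omega))$ and $p\in L^{3/2}(\omega\times(a,b))$; (ii) $\int_a^b\int_\omega\{-u\cdot\psi_t+\nabla u:\nabla\psi-(u\otimes u):\nabla\psi-p\,\operatorname{div}\psi\}\,dx\,dt=0$ for all $\psi\in C_0^\infty(\omega\times(a,b);\mathbb R^3)$, and for a.e. $t\in(a,b)$, $\int_\omega u(x,t)\cdot\nabla\phi(x)\,dx=0$ for all real-valued $\phi\in C_0^\infty(\omega)$; (iii) for a.e. $t\in(a,b)$ and every nonnegative $\phi\in C_0^\infty(\mathbb R^3\times\mathbb R)$ vanishing in a neighborhood of $\omega\times\{a\}\cup\partial\omega\times[a,b]$,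 $$\int_\omega|u(x,t)|^2\phi(x,t)\,dx+2\int_a^t\int_\omega|\nabla u|^2\phi\,dx\,ds\le\int_a^t\int_\omega|u|^2(\phi_t+\Delta\phi)\,dx\,ds+\int_a^t\int_\omega(|u|^2+2p)\,u\cdot\nabla\phi\,dx\,ds .$$ For $z_0=(x_0,t_0)$ and $r>0$ put $$A(z_0,r)=\operatorname*{ess\,sup}_{t_0-r^2\le t\le t_0}\frac1r\int_{B_r(x_0)}|u(x,t)|^2\,dx,\qquad B(z_0,r)=\frac1r\int_{Q_r(z_0)}|\nabla u|^2\,dx\,dt,$$ $$D(z_0,r)=\frac1{r^3}\int_{t_0-r^2}^{t_0}\|p(\cdot,t)\|_{L^{6/5}(B_r(x_0))}^2\,dt,\qquad D_1(z_0,r)=\frac1{r^2}\int_{t_0-r^2}^{t_0}\|p(\cdot,t)\|_{L^{3/2}(B_r(x_0))}^{3/2}\,dt,$$ where $D$ may be $+\infty$. **Lemma.** There is an absolute constant $C>0$ such that the following holds. Let $(u,p)$ be a suitable weak solution of the Navier–Stokes equations in $Q=\omega\times(a,b)$, and let $z_0=(x_0,t_0)$ and $\rho>0$ be such that $Q_\rho(z_0)\subset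 Q$. Then for every $r\in(0,\rho/4]$, $$D_1(z_0,r)\le C\Big(\frac{\rho}{r}\Big)^{3/2}A(z_0,\rho)^{3/4}B(z_0,\rho)^{3/4}+C\Big(\frac{r}{\rho}\Big)^{3/2}D(z_0,\rho)^{3/4}.$$ -/

import Mathlib

open MeasureTheory Set
open scoped ENNReal

namespace NavierStokes

/-- Three-dimensional Euclidean space. -/
abbrev E3 : Type := EuclideanSpace ℝ (Fin 3)

/-- Real `3 × 3` arrays with the Euclidean (Frobenius) norm `|M|² = ∑ i j, (M i j)²`. -/
abbrev M3 : Type := EuclideanSpace ℝ (Fin 3 × Fin 3)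

/-- The spatial partial derivative `∂f/∂x_j` of a function of `z = (x, t)`. -/
noncomputable def dx {F : Type*} [NormedAddCommGroup F] [NormedSpace ℝ F]
    (j : Fin 3) (f : E3 × ℝ → F) (z : E3 × ℝ) : F :=
  fderiv ℝ f z (EuclideanSpace.single j 1, 0)

/-- The time derivative `∂f/∂t` of a function of `z = (x, t)`. -/
noncomputable def dt {F : Type*} [NormedAddCommGroup F] [NormedSpace ℝ F]
    (f : E3 × ℝ → F) (z : E3 × ℝ) : F :=
  fderiv ℝ f z (0, 1)

/-- The spatial Laplacian of a function of `z = (x, t)`. -/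
noncomputable def spaceLaplacian (f : E3 × ℝ → ℝ) (z : E3 × ℝ) : ℝ :=
  ∑ j, dx j (dx j f) z

/-- The parabolic cylinder `Q_r(z) = B_r(x) × (t - r², t)`, where `z = (x, t)`. -/
def cylinder (z : E3 × ℝ) (r : ℝ) : Set (E3 × ℝ) :=
  Metric.ball z.1 r ×ˢ Ioo (z.2 - r ^ 2) z.2

/-- `f ∈ C_0^∞(U)`: smooth, with compact support contained in `U`. -/
structure IsTestFunction {X F : Type*} [NormedAddCommGroup X] [NormedSpace ℝ X]
    [NormedAddCommGroup F] [NormedSpace ℝ F] (U : Set X) (f : X → F) : Prop where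
  smooth : ContDiff ℝ (⊤ : ℕ∞) f
  compact : HasCompactSupport f
  support_subset : tsupport f ⊆ U

/-- `g` is the weak (distributional) gradient of the vector field `v` on the open set `Ω`:
`g (i, j) = ∂_j v_i` in the sense of distributions. -/
structure IsWeakGradient (Ω : Set E3) (v : E3 → E3) (g : E3 → M3) : Prop where
  locallyIntegrable : LocallyIntegrableOn v Ω
  locallyIntegrable_grad : LocallyIntegrableOn g Ω
  integral_eq : ∀ φ : E3 → ℝ, IsTestFunction Ω φ → ∀ i j : Fin 3,
    ∫ x in Ω, v x i * fderiv ℝ φ x (EuclideanSpace.single j 1) = - ∫ x in Ω, g x (i, j) * φ x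

/-- The parabolic boundary `Ω × {a} ∪ ∂Ω × [a, b]` of `Ω × (a, b)`. -/
def parabolicBoundary (Ω : Set E3) (a b : ℝ) : Set (E3 × ℝ) :=
  Ω ×ˢ {a} ∪ frontier Ω ×ˢ Icc a b

/-- `(u, p)` is a suitable weak solution of the Navier–Stokes equations (unit viscosity, no force)
in `Ω × (a, b)`, and `G` is the spatial weak gradient `∇u`.  (`G` is determined by `u` up to a null
set of `Ω × (a, b)`; carrying it along avoids choosing a representative.) -/
structure IsSuitableWeakSolution (Ω : Set E3) (a b : ℝ)
    (u : E3 × ℝ → E3) (G : E3 × ℝ → M3) (p : E3 × ℝ → ℝ) : Prop where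
  /-- `u ∈ L²(Ω × (a, b))`; this also carries the measurability of `u`. -/
  velocity_L2 : MemLp u 2 (volume.restrict (Ω ×ˢ Ioo a b))
  /-- `u ∈ L^∞(a, b; L²(Ω))`. -/
  velocity_bounded :
    essSup (fun t : ℝ => eLpNorm (fun x : E3 => u (x, t)) 2 (volume.restrict Ω))
      (volume.restrict (Ioo a b)) < ⊤
  /-- For almost every `t`, `∇u(·, t) = G(·, t)` weakly in `Ω`. -/
  weak_gradient : ∀ᵐ t ∂(volume.restrict (Ioo a b)),
    IsWeakGradient Ω (fun x => u (x, t)) (fun x => G (x, t))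
  /-- `∇u ∈ L²(Ω × (a, b))`, so that `u ∈ L²(a, b; W^{1,2}(Ω))`. -/
  gradient_L2 : MemLp G 2 (volume.restrict (Ω ×ˢ Ioo a b))
  /-- `p ∈ L^{3/2}(Ω × (a, b))`. -/
  pressure_mem : MemLp p (3 / 2) (volume.restrict (Ω ×ˢ Ioo a b))
  /-- The momentum equation in the sense of distributions. -/
  momentum : ∀ ψ : E3 × ℝ → E3, IsTestFunction (Ω ×ˢ Ioo a b) ψ →
    ∫ z in Ω ×ˢ Ioo a b,
      (- (∑ i, u z i * dt ψ z i) + (∑ i, ∑ j, G z (i, j) * dx j ψ z i)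
        - (∑ i, ∑ j, u z i * u z j * dx j ψ z i) - p z * ∑ i, dx i ψ z i) = 0
  /-- The velocity is divergence free at almost every time. -/
  divergence_free : ∀ᵐ t ∂(volume.restrict (Ioo a b)), ∀ φ : E3 → ℝ, IsTestFunction Ω φ →
    ∫ x in Ω, ∑ i, u (x, t) i * fderiv ℝ φ x (EuclideanSpace.single i 1) = 0
  /-- The local generalized energy inequality. -/
  energy : ∀ᵐ t ∂(volume.restrict (Ioo a b)), ∀ φ : E3 × ℝ → ℝ, IsTestFunction univ φ →
    (∀ z, 0 ≤ φ z) →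
    (∃ U : Set (E3 × ℝ), IsOpen U ∧ parabolicBoundary Ω a b ⊆ U ∧ ∀ z ∈ U, φ z = 0) →
    (∫ x in Ω, ‖u (x, t)‖ ^ 2 * φ (x, t)) + 2 * ∫ z in Ω ×ˢ Ioo a t, ‖G z‖ ^ 2 * φ z
      ≤ (∫ z in Ω ×ˢ Ioo a t, ‖u z‖ ^ 2 * (dt φ z + spaceLaplacian φ z))
        + ∫ z in Ω ×ˢ Ioo a t, (‖u z‖ ^ 2 + 2 * p z) * ∑ i, u z i * dx i φ z

/-- `A(u, z₀, r) = sup_{t₀ - r² ≤ t ≤ t₀} r⁻¹ ∫_{B_r(x₀)} |u(x, t)|² dx`.  Since `u` is only defined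
up to null sets, the supremum is the essential one (which never exceeds the pointwise one). -/
noncomputable def scaledA (u : E3 × ℝ → E3) (z : E3 × ℝ) (r : ℝ) : ℝ≥0∞ :=
  essSup (fun t : ℝ => ENNReal.ofReal r⁻¹ * ∫⁻ x in Metric.ball z.1 r, ‖u (x, t)‖ₑ ^ 2)
    (volume.restrict (Icc (z.2 - r ^ 2) z.2))

/-- `B(u, z₀, r) = r⁻¹ ∫_{Q_r(z₀)} |∇u|² dx dt`, where `G = ∇u`. -/
noncomputable def scaledB (G : E3 × ℝ → M3) (z : E3 × ℝ) (r : ℝ) : ℝ≥0∞ :=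
  ENNReal.ofReal r⁻¹ * ∫⁻ w in cylinder z r, ‖G w‖ₑ ^ 2

/-- `D(p, z₀, r) = r⁻³ ∫_{t₀ - r²}^{t₀} ‖p(·, t)‖²_{L^{6/5}(B_r(x₀))} dt` (possibly infinite). -/
noncomputable def scaledD (p : E3 × ℝ → ℝ) (z : E3 × ℝ) (r : ℝ) : ℝ≥0∞ :=
  ENNReal.ofReal (r⁻¹ ^ 3) * ∫⁻ t in Ioo (z.2 - r ^ 2) z.2,
    eLpNorm (fun x : E3 => p (x, t)) (6 / 5) (volume.restrict (Metric.ball z.1 r)) ^ 2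

/-- `D₁(p, z₀, r) = r⁻² ∫_{t₀ - r²}^{t₀} ‖p(·, t)‖^{3/2}_{L^{3/2}(B_r(x₀))} dt`. -/
noncomputable def scaledD₁ (p : E3 × ℝ → ℝ) (z : E3 × ℝ) (r : ℝ) : ℝ≥0∞ :=
  ENNReal.ofReal (r⁻¹ ^ 2) * ∫⁻ t in Ioo (z.2 - r ^ 2) z.2,
    eLpNorm (fun x : E3 => p (x, t)) (3 / 2) (volume.restrict (Metric.ball z.1 r)) ^ (3 / 2 : ℝ)

end NavierStokes

/-! At almost every time the pressure solves `-Δp = ∂ᵢ∂ⱼ(uᵢuⱼ)`, and it is recovered by telescoping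
averages over dyadic scales. This avoids both singular integrals and a harmonic decomposition of
`p`. Smoothing `1/|x|` near the origin gives `Γ` with `ΔΓ = η` supported in the unit ball. Since
`1/|x|` is homogeneous of degree -1, `Θ(x) = Γ(x) - 2Γ(2x)` has compact support
(`exists_dyadic_kernel`). Testing the pressure equation with `s⁻¹Θ((x - ·)/s)` expresses the
difference of the `η`-averages of `p` at scales `s` and `s/2` through `u ⊗ u`.

Each increment has two bounds. Directly it is at most a multiple of `s⁻³ ∫_{B(x,2s)} |u|²`. Because
`u` is divergence free, constants may be subtracted from `u` (`doubleDiv_sub_const`), and a Poincaré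
inequality then gives `s⁻¹ ∫_{B(x,4s)} |∇u|²`. Taking `L^{3/2}` norms in `x` gains `s²`, which
leaves the minimum of `s⁻¹ ∫|u|²` and `s ∫|∇u|²`. Over dyadic `s` these minima sum to a multiple of
`(∫|u|² ∫|∇u|²)^{1/2}` (`sum_min_geometric_le`).

The coarsest average, at scale `ρ/8`, is controlled pointwise by the `L^{6/5}` norm of `p`, and the
averages converge a.e. to `(∫η) p`. Together these give the slice bound `exists_slice_estimate`.
Raising it to the power 3/2, taking the supremum in time of the kinetic factor and applying Hölder
in time to the other factors yields the claim. -/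

namespace NavierStokes

/-! ### The compactly supported dyadic kernel built from the Newton potential. -/

/-- The partial derivative `∂f/∂x_i` on `ℝ³`. -/
noncomputable def pd (i : Fin 3) (f : E3 → ℝ) (x : E3) : ℝ :=
  fderiv ℝ f x (EuclideanSpace.single i 1)

theorem pd_radial {g : ℝ → ℝ} (hg : Differentiable ℝ g) (i : Fin 3) (x : E3) :
    pd i (fun x => g (‖x‖ ^ 2)) x = 2 * x i * deriv g (‖x‖ ^ 2) := by
  have h1 : HasFDerivAt (fun x : E3 => ‖x‖ ^ 2) (2 • innerSL ℝ x) x :=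
    (hasStrictFDerivAt_norm_sq x).hasFDerivAt
  have h2 := ((hg (‖x‖ ^ 2)).hasDerivAt.comp_hasFDerivAt x h1)
  unfold pd
  erw [h2.fderiv]
  simp only [smul_apply, innerSL_apply_apply, EuclideanSpace.inner_single_right]
  simp
  ring

theorem pd_coord_mul {f : E3 → ℝ} (hf : Differentiable ℝ f) (i : Fin 3) (x : E3) :
    pd i (fun x => 2 * x i * f x) x = 2 * f x + 2 * x i * pd i f x := by
  have h1 : HasFDerivAt (fun x : E3 => 2 * x i) ((2 : ℝ) • (EuclideanSpace.proj i : E3 →L[ℝ] ℝ)) x :=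
    ((EuclideanSpace.proj i : E3 →L[ℝ] ℝ).hasFDerivAt).const_mul 2
  have h2 := h1.mul (hf x).hasFDerivAt
  unfold pd
  erw [h2.fderiv]
  simp
  ring

theorem laplacian_radial {g : ℝ → ℝ} (hg : ContDiff ℝ (⊤ : ℕ∞) g) (x : E3) :
    ∑ i, pd i (pd i (fun x => g (‖x‖ ^ 2))) x =
      6 * deriv g (‖x‖ ^ 2) + 4 * ‖x‖ ^ 2 * deriv (deriv g) (‖x‖ ^ 2) := by
  have hg' : ContDiff ℝ (⊤ : ℕ∞) (deriv g) := by
    have := (contDiff_infty_iff_deriv (𝕜 := ℝ)).1 hg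
    exact this.2
  have hd : Differentiable ℝ g := hg.differentiable (by simp)
  have hd' : Differentiable ℝ (deriv g) := hg'.differentiable (by simp)
  have hn : ∑ i, (x i) ^ 2 = ‖x‖ ^ 2 := by
    rw [EuclideanSpace.norm_sq_eq]; simp
  have key : ∀ i, pd i (pd i (fun x => g (‖x‖ ^ 2))) x =
      2 * deriv g (‖x‖ ^ 2) + 4 * (x i) ^ 2 * deriv (deriv g) (‖x‖ ^ 2) := by
    intro i
    have : pd i (fun x => g (‖x‖ ^ 2)) = fun x => 2 * x i * deriv g (‖x‖ ^ 2) :=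
      funext fun x => pd_radial hd i x
    rw [this, pd_coord_mul (f := fun x => deriv g (‖x‖ ^ 2)) _ i x, pd_radial hd']
    · ring
    · exact hd'.comp (differentiable_id.norm_sq ℝ)
  simp_rw [key]
  simp only [Fin.sum_univ_three] at hn ⊢
  linear_combination 4 * deriv (deriv g) (‖x‖ ^ 2) * hn

/-- A smooth function on `ℝ` that equals `1 / √s` for `s ≥ 1`. -/
noncomputable def newtonProfile (s : ℝ) : ℝ := Real.smoothTransition (2 * s - 1) * (√s)⁻¹

/-- The cutoff vanishes for `s ≤ 1/2`, so the singularity of `1/√s` at the origin is never seen. -/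
theorem contDiff_newtonProfile : ContDiff ℝ (⊤ : ℕ∞) newtonProfile := by
  rw [contDiff_iff_contDiffAt]
  intro s
  rcases lt_or_ge s (1 / 2) with h | h
  · refine (contDiffAt_const (c := (0 : ℝ))).congr_of_eventuallyEq ?_
    filter_upwards [Iio_mem_nhds h] with y hy
    rw [newtonProfile, Real.smoothTransition.zero_of_nonpos, zero_mul]
    simp only [mem_Iio] at hy
    linarith
  · have hs : s ≠ 0 := by linarith
    refine ContDiffAt.mul ?_ ?_
    · exact Real.smoothTransition.contDiff.contDiffAt.comp s (by fun_prop)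
    · exact (Real.contDiffAt_sqrt hs).inv (by
        have : 0 < √s := Real.sqrt_pos.2 (by linarith)
        exact this.ne')

theorem newtonProfile_of_one_le {s : ℝ} (h : 1 ≤ s) : newtonProfile s = (√s)⁻¹ := by
  rw [newtonProfile, Real.smoothTransition.one_of_one_le (by linarith), one_mul]

theorem deriv_newtonProfile {s : ℝ} (h : 1 < s) :
    deriv newtonProfile s = -(1 / 2) * s ^ (-(3 / 2) : ℝ) := by
  have h1 : newtonProfile =ᶠ[nhds s] fun s => s ^ (-(1 / 2) : ℝ) := by
    filter_upwards [Ioi_mem_nhds h] with y hy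
    rw [newtonProfile_of_one_le hy.le, Real.sqrt_eq_rpow, Real.rpow_neg (by linarith [mem_Ioi.1 hy])]
  rw [h1.deriv_eq, (Real.hasDerivAt_rpow_const (Or.inl (by linarith))).deriv]
  norm_num

theorem deriv_deriv_newtonProfile {s : ℝ} (h : 1 < s) :
    deriv (deriv newtonProfile) s = 3 / 4 * s ^ (-(5 / 2) : ℝ) := by
  have h1 : deriv newtonProfile =ᶠ[nhds s] fun s => -(1 / 2) * s ^ (-(3 / 2) : ℝ) := by
    filter_upwards [Ioi_mem_nhds h] with y hy using deriv_newtonProfile hy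
  rw [h1.deriv_eq, ((Real.hasDerivAt_rpow_const (Or.inl (by linarith))).const_mul _).deriv,
    ← mul_assoc]
  norm_num

/-- The radial profile of the Laplacian of `x ↦ newtonProfile (‖x‖ ^ 2)`. -/
noncomputable def sourceProfile (s : ℝ) : ℝ :=
  6 * deriv newtonProfile s + 4 * s * deriv (deriv newtonProfile) s

theorem contDiff_deriv_newtonProfile : ContDiff ℝ (⊤ : ℕ∞) (deriv newtonProfile) :=
  ((contDiff_infty_iff_deriv (𝕜 := ℝ)).1 contDiff_newtonProfile).2

theorem contDiff_deriv_deriv_newtonProfile : ContDiff ℝ (⊤ : ℕ∞) (deriv (deriv newtonProfile)) :=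
  ((contDiff_infty_iff_deriv (𝕜 := ℝ)).1 contDiff_deriv_newtonProfile).2

theorem continuous_sourceProfile : Continuous sourceProfile := by
  have := contDiff_deriv_newtonProfile.continuous
  have := contDiff_deriv_deriv_newtonProfile.continuous
  unfold sourceProfile
  fun_prop

/-- Harmonicity of `1/|x|` in dimension three. The inequality is strict because the derivative
formulas need the explicit form on a neighbourhood of `s`. -/
theorem sourceProfile_eq_zero {s : ℝ} (h : 1 < s) : sourceProfile s = 0 := by
  have h0 : 0 < s := by linarith
  rw [sourceProfile, deriv_newtonProfile h, deriv_deriv_newtonProfile h]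
  have : s ^ (-(3 / 2) : ℝ) = s * s ^ (-(5 / 2) : ℝ) := by
    rw [← Real.rpow_one_add' h0.le (by norm_num)]; norm_num
  rw [this]; ring

/-- By the divergence theorem the integral is the flux of `∇(1/|x|)` through large spheres, which is
nonzero. In polar coordinates the integrand is the derivative of `2y³N'(y²)` with `N` the profile,
and this primitive equals -1 for `y > 1`. Nonvanishing matters because the limit of the averages is
later divided by this integral. -/
theorem integral_sourceProfile_ne_zero : ∫ x : E3, sourceProfile (‖x‖ ^ 2) ≠ 0 := by
  have h := integral_fun_norm_addHaar (volume : Measure E3) (fun y => sourceProfile (y ^ 2))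
  simp only [finrank_euclideanSpace, Fintype.card_fin, smul_eq_mul] at h
  rw [h]
  have hv : (volume : Measure E3).real (Metric.ball 0 1) ≠ 0 := by
    have h1 := Metric.measure_ball_pos (volume : Measure E3) 0 one_pos
    exact (ENNReal.toReal_pos h1.ne' measure_ball_lt_top.ne).ne'
  have hd : ∀ y : ℝ, HasDerivAt (fun y => 2 * y ^ 3 * deriv newtonProfile (y ^ 2))
      (y ^ 2 * sourceProfile (y ^ 2)) y := by
    intro y
    have h1 : HasDerivAt (deriv newtonProfile) (deriv (deriv newtonProfile) (y ^ 2)) (y ^ 2) :=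
      (contDiff_deriv_newtonProfile.differentiable (by simp) _).hasDerivAt
    have h2 := HasDerivAt.comp (h := fun y : ℝ => y ^ 2) y h1 (hasDerivAt_pow 2 y)
    have h3 := ((hasDerivAt_pow 3 y).const_mul 2).mul h2
    refine h3.congr_deriv ?_
    simp [sourceProfile]
    ring
  have hint : IntegrableOn (fun y : ℝ => y ^ 2 * sourceProfile (y ^ 2)) (Ioi 0) := by
    have hc : Continuous (fun y : ℝ => y ^ 2 * sourceProfile (y ^ 2)) := by
      have := continuous_sourceProfile
      fun_prop
    refine (hc.integrable_of_hasCompactSupport ?_).integrableOn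
    refine HasCompactSupport.intro (isCompact_Icc (a := -1) (b := 1)) fun y hy => ?_
    have : 1 < y ^ 2 := by
      by_contra! hcon
      exact hy (abs_le.1 ((sq_le_one_iff_abs_le_one y).1 hcon))
    rw [sourceProfile_eq_zero this, mul_zero]
  have hlim : Filter.Tendsto (fun y : ℝ => 2 * y ^ 3 * deriv newtonProfile (y ^ 2)) Filter.atTop
      (nhds (-1)) := by
    refine tendsto_const_nhds.congr' ?_
    filter_upwards [Filter.eventually_gt_atTop 1] with y hy
    have hy0 : 0 < y := by linarith
    rw [deriv_newtonProfile (by nlinarith), ← Real.rpow_natCast, ← Real.rpow_natCast,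
      ← Real.rpow_mul hy0.le]
    norm_num
    field_simp
  have hI := integral_Ioi_of_hasDerivAt_of_tendsto' (fun y _ => hd y) hint hlim
  rw [hI]
  simpa using hv

/-- A compactly supported kernel whose Laplacian is the difference of a fixed function and its
rescaling, both supported in the unit ball. -/
theorem exists_dyadic_kernel : ∃ Θ η : E3 → ℝ, ContDiff ℝ (⊤ : ℕ∞) Θ ∧ (∀ x, 1 < ‖x‖ → Θ x = 0) ∧
    Continuous η ∧ (∀ x, 1 < ‖x‖ → η x = 0) ∧ ∫ x, η x ≠ 0 ∧
    ∀ x, ∑ i, pd i (pd i Θ) x = η x - 8 * η ((2 : ℝ) • x) := by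
  have hG : ContDiff ℝ (⊤ : ℕ∞) (fun s => newtonProfile s - 2 * newtonProfile (4 * s)) := by
    have := contDiff_newtonProfile
    fun_prop
  -- This is `Γ(x) - 2Γ(2x)`: outside the unit ball both terms equal `1/|x|`. Two derivatives of the
  -- second term produce the factor `2 · 2² = 8`.
  refine ⟨fun x => newtonProfile (‖x‖ ^ 2) - 2 * newtonProfile (4 * ‖x‖ ^ 2),
    fun x => sourceProfile (‖x‖ ^ 2), ?_, ?_, ?_, ?_, integral_sourceProfile_ne_zero, ?_⟩
  · exact hG.comp (contDiff_id.norm_sq ℝ)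
  · intro x hx
    have h1 : 1 ≤ ‖x‖ ^ 2 := by nlinarith
    change newtonProfile (‖x‖ ^ 2) - 2 * newtonProfile (4 * ‖x‖ ^ 2) = 0
    rw [newtonProfile_of_one_le h1, newtonProfile_of_one_le (by linarith),
      Real.sqrt_mul (by norm_num), show (4 : ℝ) = 2 ^ 2 by norm_num,
      Real.sqrt_sq (by norm_num), mul_inv]
    ring
  · have := continuous_sourceProfile
    fun_prop
  · intro x hx
    exact sourceProfile_eq_zero (by nlinarith)
  · intro x
    rw [laplacian_radial hG x]
    have hd : Differentiable ℝ newtonProfile := contDiff_newtonProfile.differentiable (by simp)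
    have hd' : Differentiable ℝ (deriv newtonProfile) :=
      contDiff_deriv_newtonProfile.differentiable (by simp)
    have e1 : deriv (fun s => newtonProfile s - 2 * newtonProfile (4 * s)) =
        fun s => deriv newtonProfile s - 8 * deriv newtonProfile (4 * s) := by
      funext s
      have h1 := ((hd (4 * s)).hasDerivAt.comp s ((hasDerivAt_id s).const_mul 4)).const_mul 2
      refine ((hd s).hasDerivAt.sub h1).deriv.trans ?_
      ring
    have e2 : ∀ s, deriv (fun s => deriv newtonProfile s - 8 * deriv newtonProfile (4 * s)) s =
        deriv (deriv newtonProfile) s - 32 * deriv (deriv newtonProfile) (4 * s) := by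
      intro s
      have h1 := ((hd' (4 * s)).hasDerivAt.comp s ((hasDerivAt_id s).const_mul 4)).const_mul 8
      refine ((hd' s).hasDerivAt.sub h1).deriv.trans ?_
      ring
    rw [e1, e2]
    simp only [sourceProfile, norm_smul]
    norm_num
    rw [show (2 * ‖x‖) ^ 2 = 4 * ‖x‖ ^ 2 by ring]
    ring

end NavierStokes

/-! ### A Poincaré inequality for weak gradients, by mollification. -/

namespace NavierStokes

theorem volume_ball_E3 (z : E3) {r : ℝ} (hr : 0 < r) :
    volume (Metric.ball z r) = ENNReal.ofReal (r ^ 3) * volume (Metric.ball (0 : E3) 1) := by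
  rw [Measure.addHaar_ball_of_pos _ _ hr]
  simp

/-- Cauchy–Schwarz after the splitting `f w = w^{1/2} (f² w)^{1/2}`. -/
theorem lintegral_sq_le {α : Type*} [MeasurableSpace α] {μ : Measure α} {f w : α → ℝ≥0∞}
    (hf : AEMeasurable f μ) (hw : AEMeasurable w μ) :
    (∫⁻ a, f a * w a ∂μ) ^ 2 ≤ (∫⁻ a, w a ∂μ) * ∫⁻ a, f a ^ 2 * w a ∂μ := by
  have h := ENNReal.lintegral_mul_norm_pow_le (μ := μ) hw ((hf.pow_const 2).mul hw)
    (p := 1 / 2) (q := 1 / 2) (by norm_num) (by norm_num) (by norm_num)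
  have e : ∀ a, w a ^ (1 / 2 : ℝ) * (f a ^ 2 * w a) ^ (1 / 2 : ℝ) = f a * w a := by
    intro a
    rw [ENNReal.mul_rpow_of_nonneg _ _ (by norm_num), mul_left_comm, ← ENNReal.rpow_add_of_nonneg _ _
      (by norm_num) (by norm_num), ← ENNReal.rpow_natCast, ← ENNReal.rpow_mul]
    norm_num
  simp only [Pi.mul_apply, e] at h
  calc (∫⁻ a, f a * w a ∂μ) ^ 2 ≤ _ := pow_le_pow_left' h 2
    _ = _ := by
      rw [mul_pow, ← ENNReal.rpow_natCast, ← ENNReal.rpow_natCast, ← ENNReal.rpow_mul,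
        ← ENNReal.rpow_mul]
      norm_num

/-- The mollification of a nonnegative function restricted to a set. -/
noncomputable def mollify (φ : E3 → ℝ) (W : Set E3) (γ : E3 → ℝ≥0∞) (x : E3) : ℝ≥0∞ :=
  ∫⁻ y in W, γ y * ENNReal.ofReal (φ (x - y))

theorem measurable_mollify {φ : E3 → ℝ} (hφ : Continuous φ) (W : Set E3) {γ : E3 → ℝ≥0∞}
    (hγ : Measurable γ) : Measurable (mollify φ W γ) := by
  unfold mollify
  refine Measurable.lintegral_prod_right' (f := fun p : E3 × E3 => γ p.2 * ENNReal.ofReal (φ (p.1 - p.2))) ?_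
  have : Measurable fun p : E3 × E3 => φ (p.1 - p.2) := by
    have : Continuous fun p : E3 × E3 => φ (p.1 - p.2) := by fun_prop
    exact this.measurable
  fun_prop

/-- Jensen for a weight of total mass one, followed by Tonelli. Cutting `γ` off to `W` can only
lower the mass of the weight. -/
theorem lintegral_mollify_sq_le {φ : E3 → ℝ} (hφ : Continuous φ)
    (h1 : ∫⁻ y, ENNReal.ofReal (φ y) = 1) (W : Set E3) {γ : E3 → ℝ≥0∞} (hγ : Measurable γ) :
    ∫⁻ x, mollify φ W γ x ^ 2 ≤ ∫⁻ y in W, γ y ^ 2 := by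
  have hm : Measurable fun p : E3 × E3 => ENNReal.ofReal (φ (p.1 - p.2)) := by
    have : Continuous fun p : E3 × E3 => φ (p.1 - p.2) := by fun_prop
    exact this.measurable.ennreal_ofReal
  have hmx : ∀ x, Measurable fun y => ENNReal.ofReal (φ (x - y)) := fun x =>
    hm.comp (measurable_const.prodMk measurable_id)
  have ha : ∀ x, mollify φ W γ x ^ 2 ≤ ∫⁻ y in W, γ y ^ 2 * ENNReal.ofReal (φ (x - y)) := by
    intro x
    refine (lintegral_sq_le hγ.aemeasurable (hmx x).aemeasurable).trans ?_
    refine mul_le_of_le_one_left' ?_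
    refine (setLIntegral_le_lintegral _ _).trans ?_
    rw [lintegral_sub_left_eq_self (fun y => ENNReal.ofReal (φ y)) x, h1]
  refine (lintegral_mono ha).trans ?_
  rw [lintegral_lintegral_swap]
  · refine lintegral_mono fun y => ?_
    rw [lintegral_const_mul]
    · rw [lintegral_sub_right_eq_self (fun y => ENNReal.ofReal (φ y)) y, h1, mul_one]
    · exact hm.comp (measurable_id.prodMk measurable_const)
  · exact (((hγ.comp measurable_snd).pow_const 2).mul hm).aemeasurable

/-- The fundamental theorem of calculus on the segment from `x` to `y`, which stays in the ball by
convexity, then Cauchy–Schwarz in `τ`. The factor 3 in the hypothesis comes from summing three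
coordinates. The indicator allows the segment integral to be translated later without leaving the
region where `m` is to be counted. -/
theorem enorm_sub_sq_le_of_fderiv {F : E3 → ℝ} (hF : ContDiff ℝ 1 F) {z : E3} {s : ℝ}
    {m : E3 → ℝ≥0∞} (hm : Measurable m)
    (hb : ∀ x ∈ Metric.ball z s, ∀ h : E3, ‖fderiv ℝ F x h‖ₑ ≤ 3 * ‖h‖ₑ * m x)
    {x y : E3} (hx : x ∈ Metric.ball z s) (hy : y ∈ Metric.ball z s) :
    ‖F y - F x‖ₑ ^ 2 ≤ 9 * ‖y - x‖ₑ ^ 2 * ∫⁻ τ in Ioc (0 : ℝ) 1,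
      (Metric.ball z s).indicator (fun w => m w ^ 2) (x + τ • (y - x)) := by
  have hd : ∀ τ : ℝ, HasDerivAt (fun τ : ℝ => F (x + τ • (y - x)))
      (fderiv ℝ F (x + τ • (y - x)) (y - x)) τ := by
    intro τ
    have h1 : HasDerivAt (fun τ : ℝ => x + τ • (y - x)) (y - x) τ := by
      simpa using ((hasDerivAt_id τ).smul_const (y - x)).const_add x
    exact (hF.differentiable (by simp) _).hasFDerivAt.comp_hasDerivAt τ h1
  have hc : Continuous fun τ : ℝ => fderiv ℝ F (x + τ • (y - x)) (y - x) := by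
    have := hF.continuous_fderiv (by simp)
    fun_prop
  have hI := intervalIntegral.integral_eq_sub_of_hasDerivAt (a := 0) (b := 1) (fun τ _ => hd τ)
    (hc.intervalIntegrable _ _)
  have hmem : ∀ τ ∈ Ioc (0 : ℝ) 1, x + τ • (y - x) ∈ Metric.ball z s := by
    intro τ hτ
    have := (convex_ball z s).add_smul_sub_mem hx hy ⟨hτ.1.le, hτ.2⟩
    exact this
  simp only [one_smul, zero_smul, add_zero, add_sub_cancel] at hI
  rw [← hI, intervalIntegral.integral_of_le zero_le_one]
  have h2 : ‖∫ τ in Ioc (0 : ℝ) 1, fderiv ℝ F (x + τ • (y - x)) (y - x)‖ₑ ≤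
      3 * ‖y - x‖ₑ * ∫⁻ τ in Ioc (0 : ℝ) 1, m (x + τ • (y - x)) := by
    refine (enorm_integral_le_lintegral_enorm _).trans ?_
    rw [← lintegral_const_mul _ (by fun_prop)]
    exact setLIntegral_mono (by fun_prop) fun τ hτ => hb _ (hmem τ hτ) _
  refine (pow_le_pow_left' h2 2).trans ?_
  rw [mul_pow, mul_pow]
  have h3 : (3 : ℝ≥0∞) ^ 2 = 9 := by norm_num
  rw [h3]
  gcongr
  have h4 := lintegral_sq_le (μ := volume.restrict (Ioc (0 : ℝ) 1))
    (f := fun τ => m (x + τ • (y - x))) (w := 1) (by fun_prop) (by fun_prop)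
  simp only [Pi.one_apply, mul_one, lintegral_one, Measure.restrict_apply MeasurableSet.univ,
    univ_inter, Real.volume_Ioc, sub_zero, ENNReal.ofReal_one, one_mul] at h4
  refine h4.trans (le_of_eq ?_)
  refine setLIntegral_congr_fun measurableSet_Ioc fun τ hτ => ?_
  rw [indicator_of_mem (hmem τ hτ)]

/-- With `h = y - x`, so `|h| < 2s`, translation invariance bounds the `x`-integral by `∫ m²` for
each fixed `h` and `τ`. The constant is `9 (2s)²` times the factor `(2s)³` from the volume of the
ball of `h`. -/
theorem lintegral_lintegral_enorm_sub_sq_le_of_fderiv {F : E3 → ℝ} (hF : ContDiff ℝ 1 F) {z : E3}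
    {s : ℝ} (hs : 0 < s) {m : E3 → ℝ≥0∞} (hm : Measurable m)
    (hb : ∀ x ∈ Metric.ball z s, ∀ h : E3, ‖fderiv ℝ F x h‖ₑ ≤ 3 * ‖h‖ₑ * m x) :
    ∫⁻ x in Metric.ball z s, ∫⁻ y in Metric.ball z s, ‖F y - F x‖ₑ ^ 2 ≤
      ENNReal.ofReal (288 * s ^ 5) * volume (Metric.ball (0 : E3) 1) * ∫⁻ x, m x ^ 2 := by
  set g : E3 → ℝ≥0∞ := (Metric.ball z s).indicator (fun w => m w ^ 2) with hg
  have hgm : Measurable g := (hm.pow_const 2).indicator Metric.isOpen_ball.measurableSet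
  have hB : MeasurableSet (Metric.ball z s) := Metric.isOpen_ball.measurableSet
  calc ∫⁻ x in Metric.ball z s, ∫⁻ y in Metric.ball z s, ‖F y - F x‖ₑ ^ 2
      ≤ ∫⁻ x in Metric.ball z s, ∫⁻ h in Metric.ball (0 : E3) (2 * s),
          ENNReal.ofReal (36 * s ^ 2) * ∫⁻ τ in Ioc (0 : ℝ) 1, g (x + τ • h) := by
        refine setLIntegral_mono' hB fun x hx => ?_
        rw [← lintegral_indicator hB, ← lintegral_indicator Metric.isOpen_ball.measurableSet,
          ← lintegral_add_right_eq_self _ x]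
        refine lintegral_mono fun h => ?_
        by_cases hy : h + x ∈ Metric.ball z s
        · have hh : h ∈ Metric.ball (0 : E3) (2 * s) := by
            rw [mem_ball_zero_iff]
            have e : h = (h + x - z) - (x - z) := by abel
            rw [Metric.mem_ball, dist_eq_norm] at hx hy
            rw [e]
            exact (norm_sub_le _ _).trans_lt (by linarith)
          rw [indicator_of_mem hy, indicator_of_mem hh]
          refine (enorm_sub_sq_le_of_fderiv hF hm hb hx hy).trans ?_
          rw [add_sub_cancel_right]
          gcongr
          rw [mem_ball_zero_iff] at hh
          rw [← ofReal_norm, ← ENNReal.ofReal_pow (norm_nonneg _),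
            show (9 : ℝ≥0∞) = ENNReal.ofReal 9 by simp,
            ← ENNReal.ofReal_mul (by norm_num)]
          refine ENNReal.ofReal_le_ofReal ?_
          nlinarith [norm_nonneg h]
        · rw [indicator_of_notMem hy]
          exact zero_le
    _ = ENNReal.ofReal (36 * s ^ 2) * ∫⁻ h in Metric.ball (0 : E3) (2 * s), ∫⁻ τ in Ioc (0 : ℝ) 1,
          ∫⁻ x in Metric.ball z s, g (x + τ • h) := by
        have m1 : Measurable fun p : E3 × E3 => ∫⁻ τ in Ioc (0 : ℝ) 1, g (p.1 + τ • p.2) := by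
          refine Measurable.lintegral_prod_right'
            (f := fun q : (E3 × E3) × ℝ => g (q.1.1 + q.2 • q.1.2)) ?_
          fun_prop
        rw [lintegral_lintegral_swap (m1.const_mul _).aemeasurable]
        rw [← lintegral_const_mul]
        · refine lintegral_congr fun h => ?_
          have m2 : Measurable fun x : E3 => ∫⁻ τ in Ioc (0 : ℝ) 1, g (x + τ • h) :=
            Measurable.lintegral_prod_right' (f := fun q : E3 × ℝ => g (q.1 + q.2 • h))
              (by fun_prop)
          rw [lintegral_const_mul _ m2]
          rw [lintegral_lintegral_swap]
          refine Measurable.aemeasurable ?_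
          exact hgm.comp (by fun_prop)
        · refine Measurable.lintegral_prod_right'
            (f := fun q : E3 × ℝ => ∫⁻ x in Metric.ball z s, g (x + q.2 • q.1)) ?_
          refine Measurable.lintegral_prod_right'
            (f := fun q : (E3 × ℝ) × E3 => g (q.2 + q.1.2 • q.1.1)) ?_
          fun_prop
    _ ≤ ENNReal.ofReal (36 * s ^ 2) * ∫⁻ h in Metric.ball (0 : E3) (2 * s), ∫⁻ τ in Ioc (0 : ℝ) 1,
          ∫⁻ x, m x ^ 2 := by
        refine mul_le_mul_right (lintegral_mono fun h => lintegral_mono fun τ => ?_) _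
        refine (setLIntegral_le_lintegral _ _).trans ?_
        rw [lintegral_add_right_eq_self g (τ • h)]
        exact lintegral_mono fun x => indicator_le_self _ _ x
    _ = _ := by
        simp only [lintegral_const, Measure.restrict_apply MeasurableSet.univ, univ_inter,
          Real.volume_Ioc, sub_zero, ENNReal.ofReal_one, mul_one]
        rw [volume_ball_E3 0 (by positivity : 0 < 2 * s),
          show 288 * s ^ 5 = 36 * s ^ 2 * (2 * s) ^ 3 by ring,
          ENNReal.ofReal_mul (by positivity : 0 ≤ 36 * s ^ 2)]
        ring

open scoped Convolution in
theorem hasFDerivAt_integral_mul_kernel {f K : E3 → ℝ} (hf : LocallyIntegrable f)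
    (hK : ContDiff ℝ 1 K) (hKc : HasCompactSupport K) (x h : E3) :
    DifferentiableAt ℝ (fun x => ∫ y, f y * K (x - y)) x ∧
    fderiv ℝ (fun x => ∫ y, f y * K (x - y)) x h = ∫ y, f y * fderiv ℝ K (x - y) h := by
  have h1 := hKc.hasFDerivAt_convolution_right (ContinuousLinearMap.lsmul ℝ ℝ) hf hK x
  have e : (f ⋆[ContinuousLinearMap.lsmul ℝ ℝ, volume] K) = fun x => ∫ y, f y * K (x - y) := by
    funext x
    simp [convolution_def]
  rw [e] at h1
  refine ⟨h1.differentiableAt, ?_⟩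
  rw [h1.fderiv, convolution_precompR_apply _ hf (hKc.fderiv ℝ) (hK.continuous_fderiv (by simp))]
  simp [convolution_def]

open scoped Convolution in
theorem contDiff_integral_mul_kernel {f K : E3 → ℝ} (hf : LocallyIntegrable f)
    (hK : ContDiff ℝ (⊤ : ℕ∞) K) (hKc : HasCompactSupport K) :
    ContDiff ℝ (⊤ : ℕ∞) (fun x => ∫ y, f y * K (x - y)) := by
  have e : (f ⋆[ContinuousLinearMap.lsmul ℝ ℝ, volume] K) = fun x => ∫ y, f y * K (x - y) := by
    funext x
    simp [convolution_def]
  rw [← e]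
  exact hKc.contDiff_convolution_right _ hf hK

theorem pd_comp_const_sub {K : E3 → ℝ} (hK : Differentiable ℝ K) (x : E3) (j : Fin 3) (y : E3) :
    pd j (fun y => K (x - y)) y = - pd j K (x - y) := by
  have h1 := HasFDerivAt.comp y (hK (x - y)).hasFDerivAt ((hasFDerivAt_id y).const_sub x)
  have h2 : fderiv ℝ (fun y => K (x - y)) y = _ := h1.fderiv
  rw [pd, pd, h2]
  simp

theorem fderiv_apply_eq_sum (K : E3 → ℝ) (x h : E3) :
    fderiv ℝ K x h = ∑ j, h j * pd j K x := by
  conv_lhs => rw [← (EuclideanSpace.basisFun (Fin 3) ℝ).sum_repr h]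
  simp [pd]

theorem isTestFunction_kernel {K : E3 → ℝ} (hK : ContDiff ℝ (⊤ : ℕ∞) K) {δ : ℝ}
    (hKs : ∀ x, δ < ‖x‖ → K x = 0) {x : E3} {W : Set E3} (hW : Metric.closedBall x δ ⊆ W) :
    IsTestFunction W (fun y => K (x - y)) := by
  have hz : ∀ y, y ∉ Metric.closedBall x δ → K (x - y) = 0 := by
    intro y hy
    apply hKs
    rw [Metric.mem_closedBall, dist_comm, dist_eq_norm] at hy
    exact not_le.1 hy
  refine ⟨hK.comp (contDiff_const.sub contDiff_id), 
    HasCompactSupport.intro (isCompact_closedBall x δ) hz, ?_⟩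
  refine (closure_minimal ?_ Metric.isClosed_closedBall).trans hW
  intro y hy
  by_contra hcon
  exact hy (hz y hcon)

/-- Scalar functions `G j` are the weak partial derivatives of `f` in `W`. -/
def HasWeakPartials (W : Set E3) (f : E3 → ℝ) (G : Fin 3 → E3 → ℝ) : Prop :=
  ∀ φ : E3 → ℝ, IsTestFunction W φ → ∀ j, ∫ x in W, f x * pd j φ x = - ∫ x in W, G j x * φ x

/-- The derivative falls on the kernel and the weak gradient moves it to `f`. This is legitimate
because `K(x - ·)` is a test function in `W` when the closed `δ`-ball about `x` lies in `W`. -/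
theorem enorm_fderiv_mollification_le {W : Set E3} (hW : MeasurableSet W) {f : E3 → ℝ}
    {G : Fin 3 → E3 → ℝ} (hf : IntegrableOn f W) (hw : HasWeakPartials W f G) {γ : E3 → ℝ≥0∞}
    (hγ : ∀ j, ∀ᵐ y ∂(volume.restrict W), ‖G j y‖ₑ ≤ γ y)
    {K : E3 → ℝ} (hK : ContDiff ℝ (⊤ : ℕ∞) K) {δ : ℝ} (hKs : ∀ x, δ < ‖x‖ → K x = 0)
    (hK0 : ∀ x, 0 ≤ K x) {x : E3} (hx : Metric.closedBall x δ ⊆ W) (h : E3) :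
    ‖fderiv ℝ (fun x => ∫ y, W.indicator f y * K (x - y)) x h‖ₑ ≤ 3 * ‖h‖ₑ * mollify K W γ x := by
  have hKc : HasCompactSupport K := by
    refine HasCompactSupport.intro (isCompact_closedBall 0 δ) fun y hy => hKs y ?_
    simpa using hy
  have hf1 : LocallyIntegrable (W.indicator f) :=
    ((integrable_indicator_iff hW).2 hf).locallyIntegrable
  have key : ∀ j, fderiv ℝ (fun x => ∫ y, W.indicator f y * K (x - y)) x
      (EuclideanSpace.single j 1) = ∫ y in W, G j y * K (x - y) := by
    intro j
    rw [(hasFDerivAt_integral_mul_kernel hf1 (hK.of_le (by simp)) hKc x _).2]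
    have h1 := hw _ (isTestFunction_kernel hK hKs hx) j
    simp_rw [pd_comp_const_sub (hK.differentiable (by simp)), mul_neg, integral_neg, neg_inj] at h1
    rw [← h1, ← integral_indicator hW]
    congr 1
    funext y
    by_cases hy : y ∈ W <;> simp [hy, pd]
  have hb : ∀ j, ‖pd j (fun x => ∫ y, W.indicator f y * K (x - y)) x‖ₑ ≤ mollify K W γ x := by
    intro j
    unfold pd
    rw [key j]
    refine (enorm_integral_le_lintegral_enorm _).trans ?_
    refine lintegral_mono_ae ?_
    filter_upwards [hγ j] with y hy
    rw [enorm_mul, Real.enorm_of_nonneg (hK0 _)]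
    gcongr
  rw [fderiv_apply_eq_sum]
  calc _ ≤ ∑ j, ‖h j * pd j (fun x => ∫ y, W.indicator f y * K (x - y)) x‖ₑ := enorm_sum_le _ _
    _ ≤ ∑ j : Fin 3, ‖h‖ₑ * mollify K W γ x := by
        refine Finset.sum_le_sum fun j _ => ?_
        rw [enorm_mul]
        gcongr
        · rw [← ofReal_norm, ← ofReal_norm]
          exact ENNReal.ofReal_le_ofReal (PiLp.norm_apply_le h j)
        · exact hb j
    _ = _ := by simp [mul_assoc]

/-- A sequence of bump functions supported in the ball of radius `s` and shrinking to a point. -/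
noncomputable def shrinkingBump {s : ℝ} (hs : 0 < s) (n : ℕ) : ContDiffBump (0 : E3) :=
  ⟨s / (n + 3), s / (n + 2), by positivity, by gcongr; norm_num⟩

theorem lintegral_ofReal_normed (φ : ContDiffBump (0 : E3)) :
    ∫⁻ y, ENNReal.ofReal (φ.normed volume y) = 1 := by
  rw [← ofReal_integral_eq_lintegral_ofReal φ.integrable_normed
    (Filter.Eventually.of_forall φ.nonneg_normed), φ.integral_normed, ENNReal.ofReal_one]

/-- Outer radii are at most twice the inner ones, so the bumps are comparable to averages over balls
and Lebesgue differentiation applies. -/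
theorem ae_tendsto_integral_mul_shrinkingBump {f : E3 → ℝ} (hf : LocallyIntegrable f) {s : ℝ}
    (hs : 0 < s) : ∀ᵐ x, Filter.Tendsto
      (fun n => ∫ y, f y * (shrinkingBump hs n).normed volume (x - y)) Filter.atTop
      (nhds (f x)) := by
  have h1 := ContDiffBump.ae_convolution_tendsto_right_of_locallyIntegrable (μ := volume)
    (φ := shrinkingBump hs) (l := Filter.atTop) (K := 2) (g := f) ?_ ?_ hf
  · filter_upwards [h1] with x hx
    refine hx.congr fun n => ?_
    rw [convolution_eq_swap]
    simp only [ContinuousLinearMap.lsmul_apply, smul_eq_mul, mul_comm]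
  · refine Filter.Tendsto.const_div_atTop ?_ s
    exact Filter.tendsto_atTop_add_const_right _ _ tendsto_natCast_atTop_atTop
  · refine Filter.Eventually.of_forall fun n => ?_
    change s / (n + 2) ≤ 2 * (s / (n + 3))
    rw [← mul_div_assoc, div_le_div_iff₀ (by positivity) (by positivity)]
    have : (0 : ℝ) ≤ n := n.cast_nonneg
    nlinarith

/-- Fatou, once in each variable. -/
theorem lintegral_liminf_sub_sq_le {f : E3 → ℝ} {F : ℕ → E3 → ℝ} (hF : ∀ n, Continuous (F n))
    {S : Set E3} (hlim : ∀ᵐ x ∂(volume.restrict S),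
      Filter.Tendsto (fun n => F n x) Filter.atTop (nhds (f x))) {C : ℝ≥0∞}
    (hbound : ∀ n, ∫⁻ x in S, ∫⁻ y in S, ‖F n y - F n x‖ₑ ^ 2 ≤ C) :
    ∫⁻ x in S, ∫⁻ y in S, ‖f y - f x‖ₑ ^ 2 ≤ C := by
  have hmeas : ∀ n, Measurable fun p : E3 × E3 => ‖F n p.2 - F n p.1‖ₑ ^ 2 := by
    intro n
    have := (hF n).measurable
    fun_prop
  calc ∫⁻ x in S, ∫⁻ y in S, ‖f y - f x‖ₑ ^ 2
      = ∫⁻ x in S, ∫⁻ y in S, Filter.liminf (fun n => ‖F n y - F n x‖ₑ ^ 2) Filter.atTop := by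
        refine lintegral_congr_ae ?_
        filter_upwards [hlim] with x hx
        refine lintegral_congr_ae ?_
        filter_upwards [hlim] with y hy
        exact (((ENNReal.continuous_pow 2).tendsto _).comp (hy.sub hx).enorm).liminf_eq.symm
    _ ≤ ∫⁻ x in S, Filter.liminf (fun n => ∫⁻ y in S, ‖F n y - F n x‖ₑ ^ 2) Filter.atTop :=
        lintegral_mono fun x => lintegral_liminf_le fun n =>
          (hmeas n).comp (measurable_const.prodMk measurable_id)
    _ ≤ Filter.liminf (fun n => ∫⁻ x in S, ∫⁻ y in S, ‖F n y - F n x‖ₑ ^ 2) Filter.atTop :=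
        lintegral_liminf_le fun n => (hmeas n).lintegral_prod_right'
    _ ≤ C := Filter.liminf_le_of_frequently_le' (Filter.Frequently.of_forall hbound)

/-- A Poincaré inequality in the form of a bound for the mean square oscillation. -/
theorem HasWeakPartials.lintegral_sub_sq_le {z : E3} {s : ℝ} (hs : 0 < s) {f : E3 → ℝ}
    {G : Fin 3 → E3 → ℝ} (hf : IntegrableOn f (Metric.ball z (2 * s)))
    (hw : HasWeakPartials (Metric.ball z (2 * s)) f G) {γ : E3 → ℝ≥0∞} (hγm : Measurable γ)
    (hγ : ∀ j, ∀ᵐ y ∂(volume.restrict (Metric.ball z (2 * s))), ‖G j y‖ₑ ≤ γ y) :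
    ∫⁻ x in Metric.ball z s, ∫⁻ y in Metric.ball z s, ‖f y - f x‖ₑ ^ 2 ≤
      ENNReal.ofReal (288 * s ^ 5) * volume (Metric.ball (0 : E3) 1) *
        ∫⁻ x in Metric.ball z (2 * s), γ x ^ 2 := by
  have hW : MeasurableSet (Metric.ball z (2 * s)) := Metric.isOpen_ball.measurableSet
  have hf1 : Integrable ((Metric.ball z (2 * s)).indicator f) := (integrable_indicator_iff hW).2 hf
  have hφr : ∀ n, (shrinkingBump hs n).rOut < s := fun n => div_lt_self hs (by
    have : (0 : ℝ) ≤ n := n.cast_nonneg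
    linarith)
  have hφs : ∀ n, ∀ x, (shrinkingBump hs n).rOut < ‖x‖ →
      (shrinkingBump hs n).normed volume x = 0 := by
    intro n x hx
    rw [← Function.notMem_support, (shrinkingBump hs n).support_normed_eq]
    simpa using hx.le
  have hφK : ∀ n, ContDiff ℝ (⊤ : ℕ∞) ((shrinkingBump hs n).normed volume) :=
    fun n => (shrinkingBump hs n).contDiff_normed
  have hFs := fun n => contDiff_integral_mul_kernel hf1.locallyIntegrable (hφK n)
    (shrinkingBump hs n).hasCompactSupport_normed
  refine lintegral_liminf_sub_sq_le (fun n => (hFs n).continuous) ?_ fun n => ?_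
  · filter_upwards [ae_restrict_of_ae
      (ae_tendsto_integral_mul_shrinkingBump hf1.locallyIntegrable hs),
      ae_restrict_mem Metric.isOpen_ball.measurableSet] with x hx hxs
    have hxW : x ∈ Metric.ball z (2 * s) := Metric.ball_subset_ball (by linarith) hxs
    rwa [indicator_of_mem hxW] at hx
  · refine (lintegral_lintegral_enorm_sub_sq_le_of_fderiv ((hFs n).of_le (by simp)) hs
      (measurable_mollify (hφK n).continuous (Metric.ball z (2 * s)) hγm) ?_).trans ?_
    · intro x hx h
      refine enorm_fderiv_mollification_le hW hf hw hγ (hφK n) (hφs n)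
        (shrinkingBump hs n).nonneg_normed ?_ h
      -- The gradient is taken on the doubled ball precisely to leave room for mollifiers of radius
      -- less than `s`.
      refine (Metric.closedBall_subset_ball (ε₂ := s) (hφr n)).trans ?_
      refine Metric.ball_subset_ball' ?_
      have := Metric.mem_ball.1 hx
      linarith
    · exact mul_le_mul_right
        (lintegral_mollify_sq_le (hφK n).continuous (lintegral_ofReal_normed _) _ hγm) _

end NavierStokes

/-! ### The pairing of `v ⊗ v` with second derivatives of test functions. -/

namespace NavierStokes

theorem ContDiff.pd {φ : E3 → ℝ} (h : ContDiff ℝ (⊤ : ℕ∞) φ) (i : Fin 3) :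
    ContDiff ℝ (⊤ : ℕ∞) (pd i φ) := by
  unfold NavierStokes.pd
  exact (h.fderiv_right (by simp)).clm_apply contDiff_const

theorem IsTestFunction.pd {W : Set E3} {φ : E3 → ℝ} (h : IsTestFunction W φ) (i : Fin 3) :
    IsTestFunction W (pd i φ) := by
  refine ⟨ContDiff.pd h.smooth i, ?_, ?_⟩
  · exact h.compact.fderiv_apply (𝕜 := ℝ) _
  · refine (closure_minimal ?_ (isClosed_tsupport φ)).trans h.support_subset
    intro x hx
    refine support_fderiv_subset ℝ (f := φ) ?_
    intro h0
    apply hx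
    change fderiv ℝ φ x _ = 0
    rw [h0]
    simp

theorem pd_comm {φ : E3 → ℝ} (h : ContDiff ℝ (⊤ : ℕ∞) φ) (i j : Fin 3) (x : E3) :
    pd i (pd j φ) x = pd j (pd i φ) x := by
  have hs : IsSymmSndFDerivAt ℝ φ x := by
    refine ContDiffAt.isSymmSndFDerivAt (n := (⊤ : ℕ∞)) h.contDiffAt ?_
    rw [minSmoothness_of_isRCLikeNormedField]
    exact WithTop.coe_le_coe.2 le_top
  have hd : DifferentiableAt ℝ (fderiv ℝ φ) x :=
    (h.fderiv_right (m := (⊤ : ℕ∞)) (by simp)).differentiable (by simp) x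
  have e : ∀ i j, pd i (pd j φ) x =
      fderiv ℝ (fderiv ℝ φ) x (EuclideanSpace.single i 1) (EuclideanSpace.single j 1) := by
    intro i j
    unfold pd
    rw [fderiv_clm_apply hd (differentiableAt_const _)]
    simp
  rw [e, e]
  exact hs.eq _ _

theorem integral_pd_eq_zero {W : Set E3} {φ : E3 → ℝ} (h : IsTestFunction W φ) (i : Fin 3) :
    ∫ x, pd i φ x = 0 := by
  have h1 := integral_mul_fderiv_eq_neg_fderiv_mul_of_integrable (μ := (volume : Measure E3))
    (f := fun _ => (1 : ℝ)) (g := φ) (v := EuclideanSpace.single i 1) (by simp) (by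
      simp only [one_mul]
      exact (h.pd i).smooth.continuous.integrable_of_hasCompactSupport (h.pd i).compact) (by
      simpa using h.smooth.continuous.integrable_of_hasCompactSupport h.compact) (by simp)
      (fun x _ => h.smooth.differentiable (by simp) x)
  simpa [pd] using h1

theorem setIntegral_pd_eq_zero {W : Set E3} {φ : E3 → ℝ} (h : IsTestFunction W φ) (i : Fin 3) :
    ∫ x in W, pd i φ x = 0 := by
  rw [setIntegral_eq_integral_of_forall_compl_eq_zero, integral_pd_eq_zero h]
  intro x hx
  by_contra hcon
  exact hx ((h.pd i).support_subset (subset_tsupport _ hcon))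

/-- The double divergence pairing `∫ (v ⊗ v) : ∇²φ`. -/
noncomputable def doubleDiv (W : Set E3) (v : E3 → E3) (φ : E3 → ℝ) : ℝ :=
  ∫ x in W, ∑ i, ∑ j, v x i * v x j * pd j (pd i φ) x

theorem IsTestFunction.bounded {W : Set E3} {φ : E3 → ℝ} (h : IsTestFunction W φ) :
    ∃ C : ℝ, ∀ x, ‖φ x‖ ≤ C :=
  h.compact.exists_bound_of_continuous h.smooth.continuous

theorem IsTestFunction.integrable_mul {W : Set E3} {φ : E3 → ℝ} (h : IsTestFunction W φ)
    {f : E3 → ℝ} {μ : Measure E3} (hf : Integrable f μ) : Integrable (fun x => f x * φ x) μ := by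
  obtain ⟨C, hC⟩ := h.bounded
  exact hf.mul_bdd h.smooth.continuous.aestronglyMeasurable (Filter.Eventually.of_forall hC)

theorem memLp_coord {α : Type*} [MeasurableSpace α] {μ : Measure α} {v : α → E3} {p : ℝ≥0∞}
    (hv : MemLp v p μ) (i : Fin 3) : MemLp (fun x => v x i) p μ :=
  hv.continuousLinearMap_comp (EuclideanSpace.proj i : E3 →L[ℝ] ℝ)

theorem integrable_coord_mul_coord {α : Type*} [MeasurableSpace α] {μ : Measure α} {v : α → E3}
    (hv : MemLp v 2 μ) (i j : Fin 3) : Integrable (fun x => v x i * v x j) μ :=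
  (memLp_coord hv i).integrable_mul (memLp_coord hv j)

theorem integral_sub_sub_add {α : Type*} [MeasurableSpace α] {μ : Measure α} {a b c d : α → ℝ}
    (ha : Integrable a μ) (hb : Integrable b μ) (hc : Integrable c μ) (hd : Integrable d μ) :
    ∫ x, (a x - b x - c x + d x) ∂μ = ∫ x, a x ∂μ - ∫ x, b x ∂μ - ∫ x, c x ∂μ + ∫ x, d x ∂μ := by
  rw [integral_add (f := fun x => a x - b x - c x) ((ha.sub hb).sub hc) hd,
    integral_sub (f := fun x => a x - b x) (ha.sub hb) hc, integral_sub ha hb]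

/-- In the expansion of `(v - c) ⊗ (v - c)` the cross terms vanish because `v` is divergence free
against the test functions `∂ᵢφ`, and the `c ⊗ c` term integrates a derivative of a test function.
Thus oscillations of `v` can replace `v` itself. -/
theorem doubleDiv_sub_const {W : Set E3} (hW : volume W ≠ ⊤) {v : E3 → E3}
    (hv : MemLp v 2 (volume.restrict W))
    (hdiv : ∀ φ : E3 → ℝ, IsTestFunction W φ → ∫ x in W, ∑ i, v x i * pd i φ x = 0)
    {φ : E3 → ℝ} (hφ : IsTestFunction W φ) (c : E3) :
    doubleDiv W (fun x => v x - c) φ = doubleDiv W v φ := by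
  have : IsFiniteMeasure (volume.restrict W) := ⟨by simpa using hW.lt_top⟩
  have i1 : ∀ i j, Integrable (fun x => v x i * v x j * pd j (pd i φ) x) (volume.restrict W) :=
    fun i j => ((hφ.pd i).pd j).integrable_mul (integrable_coord_mul_coord hv i j)
  have i2 : ∀ k i j, Integrable (fun x => v x k * pd j (pd i φ) x) (volume.restrict W) :=
    fun k i j => ((hφ.pd i).pd j).integrable_mul
      ((memLp_coord hv k).integrable (by norm_num))
  have i3 : ∀ i j, Integrable (pd j (pd i φ)) (volume.restrict W) := fun i j =>
    (((hφ.pd i).pd j).smooth.continuous.integrable_of_hasCompactSupport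
      ((hφ.pd i).pd j).compact).restrict
  have d1 : ∀ i, ∑ j, ∫ x in W, v x j * pd j (pd i φ) x = 0 := by
    intro i
    rw [← integral_finsetSum _ (fun j _ => i2 j i j)]
    exact hdiv _ (hφ.pd i)
  have d2 : ∀ j, ∑ i, ∫ x in W, v x i * pd j (pd i φ) x = 0 := by
    intro j
    rw [← d1 j]
    simp_rw [pd_comm hφ.smooth j]
  unfold doubleDiv
  have e : ∀ x, ∑ i, ∑ j, (v x - c) i * (v x - c) j * pd j (pd i φ) x =
      ∑ i, ∑ j, (v x i * v x j * pd j (pd i φ) x - c i * (v x j * pd j (pd i φ) x) -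
        c j * (v x i * pd j (pd i φ) x) + c i * c j * pd j (pd i φ) x) := by
    intro x
    refine Finset.sum_congr rfl fun i _ => Finset.sum_congr rfl fun j _ => ?_
    simp only [PiLp.sub_apply]
    ring
  simp_rw [e]
  have i4 : ∀ i j, Integrable (fun x => v x i * v x j * pd j (pd i φ) x -
      c i * (v x j * pd j (pd i φ) x) - c j * (v x i * pd j (pd i φ) x) +
      c i * c j * pd j (pd i φ) x) (volume.restrict W) := fun i j =>
    (((i1 i j).sub ((i2 j i j).const_mul _)).sub ((i2 i i j).const_mul _)).add
      ((i3 i j).const_mul _)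
  rw [integral_finsetSum _ fun i _ => integrable_finsetSum _ fun j _ => i4 i j,
    integral_finsetSum _ fun i _ => integrable_finsetSum _ fun j _ => i1 i j]
  simp_rw [integral_finsetSum Finset.univ fun j _ => i4 _ j,
    integral_finsetSum Finset.univ fun j _ => i1 _ j]
  have e2 : ∀ i j, ∫ x in W, (v x i * v x j * pd j (pd i φ) x -
      c i * (v x j * pd j (pd i φ) x) - c j * (v x i * pd j (pd i φ) x) +
      c i * c j * pd j (pd i φ) x) = (∫ x in W, v x i * v x j * pd j (pd i φ) x) -
      c i * (∫ x in W, v x j * pd j (pd i φ) x) - c j * ∫ x in W, v x i * pd j (pd i φ) x := by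
    intro i j
    rw [integral_sub_sub_add (i1 i j) ((i2 j i j).const_mul _) ((i2 i i j).const_mul _)
      ((i3 i j).const_mul _), integral_const_mul, integral_const_mul, integral_const_mul,
      setIntegral_pd_eq_zero (hφ.pd i) j]
    ring
  simp_rw [e2, Finset.sum_sub_distrib, ← Finset.mul_sum, d1]
  rw [Finset.sum_comm (f := fun i j => c j * ∫ x in W, v x i * pd j (pd i φ) x)]
  simp_rw [← Finset.mul_sum, d2]
  simp

theorem enorm_doubleDiv_le {W : Set E3} {v : E3 → E3} {φ : E3 → ℝ} {B : Set E3}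
    (hB : MeasurableSet B) {L : ℝ}
    (hL : ∀ i j x, |pd j (pd i φ) x| ≤ L) (hs : ∀ i j, ∀ x ∉ B, pd j (pd i φ) x = 0) :
    ‖doubleDiv W v φ‖ₑ ≤ ENNReal.ofReal (9 * L) * ∫⁻ x in B, ‖v x‖ₑ ^ 2 := by
  have hL0 : 0 ≤ L := (abs_nonneg _).trans (hL 0 0 0)
  calc ‖doubleDiv W v φ‖ₑ ≤ ∫⁻ x in W, ‖∑ i, ∑ j, v x i * v x j * pd j (pd i φ) x‖ₑ :=
        enorm_integral_le_lintegral_enorm _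
    _ ≤ ∫⁻ x in W, B.indicator (fun x => ENNReal.ofReal (9 * L) * ‖v x‖ₑ ^ 2) x := by
        refine lintegral_mono fun x => ?_
        by_cases hx : x ∈ B
        · rw [indicator_of_mem hx, ← ofReal_norm, ← ofReal_norm,
            ← ENNReal.ofReal_pow (norm_nonneg _), ← ENNReal.ofReal_mul (by positivity)]
          refine ENNReal.ofReal_le_ofReal ?_
          calc ‖∑ i, ∑ j, v x i * v x j * pd j (pd i φ) x‖
              ≤ ∑ i : Fin 3, ‖∑ j, v x i * v x j * pd j (pd i φ) x‖ := norm_sum_le _ _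
            _ ≤ ∑ i : Fin 3, ∑ j : Fin 3, ‖v x‖ * ‖v x‖ * L := by
                refine Finset.sum_le_sum fun i _ => (norm_sum_le _ _).trans ?_
                refine Finset.sum_le_sum fun j _ => ?_
                rw [norm_mul, norm_mul]
                gcongr
                · exact PiLp.norm_apply_le _ _
                · exact PiLp.norm_apply_le _ _
                · exact hL i j x
            _ = 9 * L * ‖v x‖ ^ 2 := by
                simp
                ring
        · rw [indicator_of_notMem hx]
          simp [hs _ _ x hx]
    _ ≤ ∫⁻ x, B.indicator (fun x => ENNReal.ofReal (9 * L) * ‖v x‖ₑ ^ 2) x :=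
        setLIntegral_le_lintegral _ _
    _ = _ := by
        rw [lintegral_indicator hB, lintegral_const_mul' _ _ ENNReal.ofReal_ne_top]

/-- The rescaling `x ↦ s⁻¹ Θ(x / s)`. -/
noncomputable def rescale (s : ℝ) (Θ : E3 → ℝ) (x : E3) : ℝ := s⁻¹ * Θ (s⁻¹ • x)

theorem contDiff_rescale {Θ : E3 → ℝ} (hΘ : ContDiff ℝ (⊤ : ℕ∞) Θ) (s : ℝ) :
    ContDiff ℝ (⊤ : ℕ∞) (rescale s Θ) := by
  unfold rescale
  fun_prop

theorem rescale_eq_zero {Θ : E3 → ℝ} (hΘ : ∀ x, 1 < ‖x‖ → Θ x = 0) {s : ℝ} (hs : 0 < s) {x : E3}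
    (hx : s < ‖x‖) : rescale s Θ x = 0 := by
  rw [rescale, hΘ, mul_zero]
  rw [norm_smul, norm_inv, Real.norm_of_nonneg hs.le, inv_mul_eq_div, one_lt_div hs]
  exact hx

theorem pd_const_mul_comp_smul {Θ : E3 → ℝ} (hΘ : Differentiable ℝ Θ) (c a : ℝ) (i : Fin 3) :
    pd i (fun x => c * Θ (a • x)) = fun x => c * a * pd i Θ (a • x) := by
  funext x
  have h1 : HasFDerivAt (fun x : E3 => a • x) (a • ContinuousLinearMap.id ℝ E3) x :=
    (hasFDerivAt_id x).const_smul a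
  have h2 := (HasFDerivAt.comp x (hΘ (a • x)).hasFDerivAt h1).const_mul c
  have h3 : fderiv ℝ (fun x => c * Θ (a • x)) x = _ := h2.fderiv
  rw [pd, h3, pd]
  simp
  ring

theorem pd_pd_rescale {Θ : E3 → ℝ} (hΘ : ContDiff ℝ (⊤ : ℕ∞) Θ) (s : ℝ) (i j : Fin 3) (x : E3) :
    pd j (pd i (rescale s Θ)) x = s⁻¹ ^ 3 * pd j (pd i Θ) (s⁻¹ • x) := by
  have e : pd i (rescale s Θ) = _ :=
    pd_const_mul_comp_smul (hΘ.differentiable (by simp)) s⁻¹ s⁻¹ i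
  rw [e, pd_const_mul_comp_smul ((ContDiff.pd hΘ i).differentiable (by simp))]
  ring

theorem pd_pd_comp_const_sub {K : E3 → ℝ} (hK : ContDiff ℝ (⊤ : ℕ∞) K) (x : E3) (i j : Fin 3)
    (y : E3) : pd j (pd i (fun y => K (x - y))) y = pd j (pd i K) (x - y) := by
  have e : pd i (fun y => K (x - y)) = fun y => - pd i K (x - y) :=
    funext fun y => pd_comp_const_sub (hK.differentiable (by simp)) x i y
  have e2 : ∀ f : E3 → ℝ, pd j (fun y => - f y) y = - pd j f y := by
    intro f
    unfold pd
    have : fderiv ℝ (fun y => - f y) y = - fderiv ℝ f y := fderiv_neg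
    rw [this]
    rfl
  rw [e, e2, pd_comp_const_sub ((ContDiff.pd hK i).differentiable (by simp)), neg_neg]

theorem pd_pd_eq_zero {Θ : E3 → ℝ} (hΘ : ∀ x, 1 < ‖x‖ → Θ x = 0) (i j : Fin 3) {x : E3}
    (hx : 1 < ‖x‖) : pd j (pd i Θ) x = 0 := by
  have aux : ∀ (f : E3 → ℝ), (∀ x, 1 < ‖x‖ → f x = 0) → ∀ i x, 1 < ‖x‖ → pd i f x = 0 := by
    intro f hf i x hx
    have : f =ᶠ[nhds x] fun _ => 0 := by
      filter_upwards [(isOpen_lt continuous_const continuous_norm).mem_nhds hx] with y hy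
        using hf y hy
    rw [pd, this.fderiv_eq]
    simp
  exact aux _ (aux Θ hΘ i) j x hx

theorem exists_bound_pd_pd {Θ : E3 → ℝ} (hΘ : ContDiff ℝ (⊤ : ℕ∞) Θ)
    (hΘs : ∀ x, 1 < ‖x‖ → Θ x = 0) : ∃ M : ℝ, ∀ i j x, |pd j (pd i Θ) x| ≤ M := by
  have h : ∀ i j, ∃ M : ℝ, ∀ x, |pd j (pd i Θ) x| ≤ M := by
    intro i j
    refine HasCompactSupport.exists_bound_of_continuous ?_
      (ContDiff.pd (ContDiff.pd hΘ i) j).continuous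
    refine HasCompactSupport.intro (isCompact_closedBall 0 1) fun x hx => pd_pd_eq_zero hΘs i j ?_
    simpa using hx
  choose M hM using h
  refine ⟨∑ i, ∑ j, |M i j|, fun i j x => (hM i j x).trans ((le_abs_self _).trans ?_)⟩
  refine le_trans ?_ (Finset.single_le_sum (f := fun i => ∑ j, |M i j|) (fun i _ =>
    Finset.sum_nonneg fun j _ => abs_nonneg _) (Finset.mem_univ i))
  exact Finset.single_le_sum (f := fun j => |M i j|) (fun j _ => abs_nonneg _) (Finset.mem_univ j)

end NavierStokes

/-! ### Bounds for the pressure increment at a single scale. -/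

namespace NavierStokes

theorem setIntegral_eq_of_isTestFunction {W W' : Set E3} (hW : MeasurableSet W) (h : W' ⊆ W)
    {φ : E3 → ℝ} (hφ : IsTestFunction W' φ) {f : E3 → ℝ} (hf : ∀ x, φ x = 0 → f x = 0) :
    ∫ x in W, f x = ∫ x in W', f x := by
  refine setIntegral_eq_of_subset_of_forall_sdiff_eq_zero hW h fun x hx => hf x ?_
  by_contra hcon
  exact hx.2 (hφ.support_subset (subset_tsupport _ hcon))

theorem IsTestFunction.mono {X F : Type*} [NormedAddCommGroup X] [NormedSpace ℝ X]
    [NormedAddCommGroup F] [NormedSpace ℝ F] {W W' : Set X} (h : W' ⊆ W) {φ : X → F}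
    (hφ : IsTestFunction W' φ) : IsTestFunction W φ :=
  ⟨hφ.smooth, hφ.compact, hφ.support_subset.trans h⟩

theorem HasWeakPartials.mono {W W' : Set E3} (hW : MeasurableSet W) (h : W' ⊆ W) {f : E3 → ℝ}
    {G : Fin 3 → E3 → ℝ} (hw : HasWeakPartials W f G) : HasWeakPartials W' f G := by
  intro φ hφ j
  have h1 := hw φ (hφ.mono h) j
  have hpd : ∀ x, x ∉ W' → pd j φ x = 0 := by
    intro x hx
    by_contra hcon
    exact hx ((hφ.pd j).support_subset (subset_tsupport _ hcon))
  rw [setIntegral_eq_of_isTestFunction hW h (hφ.pd j) (fun x hx => by rw [hx, mul_zero]),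
    setIntegral_eq_of_isTestFunction hW h hφ (fun x hx => by rw [hx, mul_zero])] at h1
  exact h1

section Kernel

variable {Θ : E3 → ℝ} {M : ℝ}

theorem isTestFunction_rescale (hΘ : ContDiff ℝ (⊤ : ℕ∞) Θ) (hΘs : ∀ x, 1 < ‖x‖ → Θ x = 0)
    {s : ℝ} (hs : 0 < s) {x : E3} {W : Set E3} (hW : Metric.closedBall x s ⊆ W) :
    IsTestFunction W (fun y => rescale s Θ (x - y)) :=
  isTestFunction_kernel (contDiff_rescale hΘ s) (fun _ => rescale_eq_zero hΘs hs) hW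

theorem one_lt_norm_smul_sub {x y : E3} {s : ℝ} (hs : 0 < s) (hy : y ∉ Metric.ball x (2 * s)) :
    1 < ‖s⁻¹ • (x - y)‖ := by
  rw [norm_smul, norm_inv, Real.norm_of_nonneg hs.le, inv_mul_eq_div, one_lt_div hs]
  rw [Metric.mem_ball, dist_comm, dist_eq_norm, not_lt] at hy
  linarith

/-- Second derivatives of the rescaled kernel are at most `s⁻³M`. They vanish off the closed
`s`-ball, and the open `2s`-ball contains it with room for the averaging used next. -/
theorem enorm_doubleDiv_rescale_le (hΘ : ContDiff ℝ (⊤ : ℕ∞) Θ) (hΘs : ∀ x, 1 < ‖x‖ → Θ x = 0)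
    (hM : ∀ i j x, |pd j (pd i Θ) x| ≤ M) {s : ℝ} (hs : 0 < s) (x : E3) (W : Set E3) (v : E3 → E3) :
    ‖doubleDiv W v (fun y => rescale s Θ (x - y))‖ₑ ≤
      ENNReal.ofReal (9 * (s⁻¹ ^ 3 * M)) * ∫⁻ y in Metric.ball x (2 * s), ‖v y‖ₑ ^ 2 := by
  refine enorm_doubleDiv_le Metric.isOpen_ball.measurableSet ?_ ?_
  · intro i j y
    rw [pd_pd_comp_const_sub (contDiff_rescale hΘ s), pd_pd_rescale hΘ, abs_mul,
      abs_of_pos (by positivity)]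
    gcongr
    exact hM i j _
  · intro i j y hy
    rw [pd_pd_comp_const_sub (contDiff_rescale hΘ s), pd_pd_rescale hΘ,
      pd_pd_eq_zero hΘs i j (one_lt_norm_smul_sub hs hy), mul_zero]

theorem enorm_sq_eq_sum (w : E3) : ‖w‖ₑ ^ 2 = ∑ i, ‖w i‖ₑ ^ 2 := by
  simp_rw [← ofReal_norm]
  rw [← ENNReal.ofReal_pow (norm_nonneg _), EuclideanSpace.norm_sq_eq,
    ENNReal.ofReal_sum_of_nonneg fun i _ => by positivity]
  simp_rw [ENNReal.ofReal_pow (norm_nonneg _)]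

theorem lintegral_lintegral_vector_sub_sq_le {v : E3 → E3} {g : E3 → M3} {γ : E3 → ℝ≥0∞} {x : E3}
    {s : ℝ} (hs : 0 < s) (hv : MemLp v 2 (volume.restrict (Metric.ball x (2 * s))))
    (hw : ∀ i, HasWeakPartials (Metric.ball x (2 * s)) (fun y => v y i) (fun j y => g y (i, j)))
    (hγm : Measurable γ)
    (hγ : ∀ᵐ y ∂(volume.restrict (Metric.ball x (2 * s))), ‖g y‖ₑ ≤ γ y) :
    ∫⁻ y' in Metric.ball x s, ∫⁻ y in Metric.ball x s, ‖v y - v y'‖ₑ ^ 2 ≤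
      ENNReal.ofReal (864 * s ^ 5) * volume (Metric.ball (0 : E3) 1) *
        ∫⁻ y in Metric.ball x (2 * s), γ y ^ 2 := by
  have : IsFiniteMeasure (volume.restrict (Metric.ball x (2 * s))) :=
    ⟨by
      rw [Measure.restrict_apply_univ]
      exact measure_ball_lt_top⟩
  have hsub : Metric.ball x s ⊆ Metric.ball x (2 * s) := Metric.ball_subset_ball (by linarith)
  have hm : ∀ i, AEMeasurable (fun y => v y i) (volume.restrict (Metric.ball x s)) := fun i =>
    (memLp_coord (hv.mono_measure (Measure.restrict_mono hsub le_rfl)) i).aemeasurable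
  have hm2 : ∀ i, AEMeasurable (fun p : E3 × E3 => ‖v p.2 i - v p.1 i‖ₑ ^ 2)
      ((volume.restrict (Metric.ball x s)).prod (volume.restrict (Metric.ball x s))) := fun i =>
    ((((hm i).comp_snd).sub ((hm i).comp_fst)).enorm).pow_const 2
  have e : ∀ y', ∫⁻ y in Metric.ball x s, ‖v y - v y'‖ₑ ^ 2 =
      ∑ i, ∫⁻ y in Metric.ball x s, ‖v y i - v y' i‖ₑ ^ 2 := by
    intro y'
    rw [← lintegral_finsetSum' _ fun i _ => (((hm i).sub_const _).enorm).pow_const 2]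
    simp_rw [enorm_sq_eq_sum]
    rfl
  simp_rw [e]
  rw [lintegral_finsetSum' _ fun i _ => (hm2 i).lintegral_prod_right']
  calc _ ≤ ∑ i : Fin 3, ENNReal.ofReal (288 * s ^ 5) * volume (Metric.ball (0 : E3) 1) *
        ∫⁻ y in Metric.ball x (2 * s), γ y ^ 2 := by
        refine Finset.sum_le_sum fun i _ => ?_
        refine HasWeakPartials.lintegral_sub_sq_le hs
          ((memLp_coord hv i).integrable (by norm_num)) (hw i) hγm fun j => ?_
        filter_upwards [hγ] with y hy
        refine le_trans ?_ hy
        rw [← ofReal_norm, ← ofReal_norm]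
        exact ENNReal.ofReal_le_ofReal (PiLp.norm_apply_le _ _)
    _ = _ := by
        rw [Finset.sum_const, Finset.card_univ, Fintype.card_fin, nsmul_eq_mul,
          show 864 * s ^ 5 = 3 * (288 * s ^ 5) by ring, ENNReal.ofReal_mul (by norm_num)]
        simp [mul_assoc]

/-- Subtract the constant `v(y')`, average over `y'` in the `2s`-ball, and apply the Poincaré bound
to the resulting double integral. The powers combine as `s⁻³ · s⁵ · s⁻³ = s⁻¹`, with constant `9 ·
864 · 2² = 31104`. -/
theorem enorm_doubleDiv_rescale_le_gradient (hΘ : ContDiff ℝ (⊤ : ℕ∞) Θ)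
    (hΘs : ∀ x, 1 < ‖x‖ → Θ x = 0) (hM : ∀ i j x, |pd j (pd i Θ) x| ≤ M) {s : ℝ} (hs : 0 < s)
    {x : E3} {W : Set E3} (hWm : MeasurableSet W) (hW : volume W ≠ ⊤)
    (hball : Metric.ball x (4 * s) ⊆ W) {v : E3 → E3} {g : E3 → M3} {γ : E3 → ℝ≥0∞}
    (hv : MemLp v 2 (volume.restrict W))
    (hdiv : ∀ φ : E3 → ℝ, IsTestFunction W φ → ∫ x in W, ∑ i, v x i * pd i φ x = 0)
    (hw : ∀ i, HasWeakPartials W (fun y => v y i) (fun j y => g y (i, j)))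
    (hγm : Measurable γ) (hγ : ∀ᵐ y ∂(volume.restrict W), ‖g y‖ₑ ≤ γ y) :
    ‖doubleDiv W v (fun y => rescale s Θ (x - y))‖ₑ ≤
      ENNReal.ofReal (31104 * (s⁻¹ * M)) * ∫⁻ y in Metric.ball x (4 * s), γ y ^ 2 := by
  have hM0 : 0 ≤ M := (abs_nonneg _).trans (hM 0 0 0)
  set φ := fun y => rescale s Θ (x - y)
  have hφ : IsTestFunction W φ := isTestFunction_rescale hΘ hΘs hs
    ((Metric.closedBall_subset_ball (by linarith)).trans hball)
  have h2s : (4 : ℝ) * s = 2 * (2 * s) := by ring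
  have hsub : Metric.ball x (2 * (2 * s)) ⊆ W := by rwa [← h2s]
  set κ := volume (Metric.ball (0 : E3) 1)
  have hκ0 : κ ≠ 0 := (Metric.measure_ball_pos _ _ one_pos).ne'
  have hκt : κ ≠ ⊤ := measure_ball_lt_top.ne
  have hvol : volume (Metric.ball x (2 * s)) = ENNReal.ofReal ((2 * s) ^ 3) * κ :=
    volume_ball_E3 x (by positivity)
  -- The left side is the integral of a constant over `y'`. The volume factor is cancelled at the
  -- end instead of dividing now.
  have key : ‖doubleDiv W v φ‖ₑ * volume (Metric.ball x (2 * s)) ≤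
      ENNReal.ofReal (9 * (s⁻¹ ^ 3 * M)) * (ENNReal.ofReal (864 * (2 * s) ^ 5) * κ *
        ∫⁻ y in Metric.ball x (2 * (2 * s)), γ y ^ 2) := by
    rw [← setLIntegral_const]
    calc _ ≤ ∫⁻ y' in Metric.ball x (2 * s), ENNReal.ofReal (9 * (s⁻¹ ^ 3 * M)) *
          ∫⁻ y in Metric.ball x (2 * s), ‖v y - v y'‖ₑ ^ 2 := by
          refine lintegral_mono fun y' => ?_
          rw [← doubleDiv_sub_const hW hv hdiv hφ (v y')]
          exact enorm_doubleDiv_rescale_le hΘ hΘs hM hs x W _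
      _ ≤ _ := by
          rw [lintegral_const_mul' _ _ ENNReal.ofReal_ne_top]
          refine mul_le_mul_right ?_ _
          exact lintegral_lintegral_vector_sub_sq_le (by positivity)
            (hv.mono_measure (Measure.restrict_mono hsub le_rfl))
            (fun i => (hw i).mono hWm hsub) hγm
            (ae_restrict_of_ae_restrict_of_subset hsub hγ)
  have hV0 : volume (Metric.ball x (2 * s)) ≠ 0 := (Metric.measure_ball_pos _ _ (by positivity)).ne'
  have hVt : volume (Metric.ball x (2 * s)) ≠ ⊤ := measure_ball_lt_top.ne
  rw [← ENNReal.mul_le_mul_iff_left hV0 hVt]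
  refine key.trans (le_of_eq ?_)
  have e : ENNReal.ofReal (9 * (s⁻¹ ^ 3 * M)) * ENNReal.ofReal (864 * (2 * s) ^ 5) =
      ENNReal.ofReal (31104 * (s⁻¹ * M)) * ENNReal.ofReal ((2 * s) ^ 3) := by
    rw [← ENNReal.ofReal_mul (by positivity), ← ENNReal.ofReal_mul (by positivity)]
    congr 1
    field_simp
    ring
  rw [hvol, h2s, ← mul_assoc, ← mul_assoc, e]
  ring

/-- Half a power of the local integral is bounded by the total integral. The remaining first power
is integrated exactly by Tonelli. -/
theorem rpow_three_halves_lintegral_ball_le {f : E3 → ℝ≥0∞} (hf : Measurable f) (R : ℝ) :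
    ∫⁻ x, (∫⁻ y in Metric.ball x R, f y) ^ (3 / 2 : ℝ) ≤
      volume (Metric.ball (0 : E3) R) * (∫⁻ y, f y) ^ (3 / 2 : ℝ) := by
  have h1 : ∀ x, (∫⁻ y in Metric.ball x R, f y) ^ (3 / 2 : ℝ) ≤
      (∫⁻ y, f y) ^ (1 / 2 : ℝ) * ∫⁻ y in Metric.ball x R, f y := by
    intro x
    rw [show (3 / 2 : ℝ) = 1 / 2 + 1 by norm_num, ENNReal.rpow_add_of_nonneg _ _ (by norm_num)
      (by norm_num), ENNReal.rpow_one]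
    exact mul_le_mul_left (ENNReal.rpow_le_rpow (setLIntegral_le_lintegral _ _) (by norm_num)) _
  have hS : MeasurableSet {p : E3 × E3 | p.2 ∈ Metric.ball p.1 R} :=
    (isOpen_lt (by fun_prop : Continuous fun p : E3 × E3 => dist p.2 p.1)
      continuous_const).measurableSet
  have hm : Measurable fun p : E3 × E3 =>
      {p : E3 × E3 | p.2 ∈ Metric.ball p.1 R}.indicator (fun p => f p.2) p :=
    (hf.comp measurable_snd).indicator hS
  have e1 : ∀ x, ∫⁻ y in Metric.ball x R, f y =
      ∫⁻ y, {p : E3 × E3 | p.2 ∈ Metric.ball p.1 R}.indicator (fun p => f p.2) (x, y) := by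
    intro x
    rw [← lintegral_indicator Metric.isOpen_ball.measurableSet]
    rfl
  have h2 : ∫⁻ x, ∫⁻ y in Metric.ball x R, f y = volume (Metric.ball (0 : E3) R) * ∫⁻ y, f y := by
    simp_rw [e1]
    rw [lintegral_lintegral_swap hm.aemeasurable, ← lintegral_const_mul _ hf]
    refine lintegral_congr fun y => ?_
    have e2 : ∀ x, {p : E3 × E3 | p.2 ∈ Metric.ball p.1 R}.indicator (fun p => f p.2) (x, y) =
        (Metric.ball y R).indicator (fun _ => f y) x := by
      intro x
      by_cases h : x ∈ Metric.ball y R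
      · rw [indicator_of_mem h, indicator_of_mem]
        exact Metric.mem_ball_comm.1 h
      · rw [indicator_of_notMem h, indicator_of_notMem]
        exact fun h' => h (Metric.mem_ball_comm.1 h')
    simp_rw [e2]
    rw [lintegral_indicator Metric.isOpen_ball.measurableSet, setLIntegral_const, mul_comm,
      Measure.addHaar_ball_center]
  refine (lintegral_mono h1).trans ?_
  have hmx : Measurable fun x => ∫⁻ y in Metric.ball x R, f y := by
    simp_rw [e1]
    exact hm.lintegral_prod_right'
  rw [lintegral_const_mul _ hmx, h2, mul_left_comm]
  rw [show (3 / 2 : ℝ) = 1 / 2 + 1 by norm_num, ENNReal.rpow_add_of_nonneg _ _ (by norm_num)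
      (by norm_num), ENNReal.rpow_one]

/-- The volume of the ball enters to the power `2/3`, hence a gain of `R²`. This gain turns the
pointwise factors `s⁻³` and `s⁻¹` into `s⁻¹` and `s`. -/
theorem eLpNorm_three_halves_le_of_ball {T : E3 → ℝ} {f : E3 → ℝ≥0∞} (hf : Measurable f) {R : ℝ}
    (hR : 0 < R) {c : ℝ≥0∞} (hc : c ≠ ⊤) {B : Set E3} (hB : MeasurableSet B)
    (h : ∀ x ∈ B, ‖T x‖ₑ ≤ c * ∫⁻ y in Metric.ball x R, f y) :
    eLpNorm T (3 / 2) (volume.restrict B) ≤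
      c * (ENNReal.ofReal (R ^ 2) * volume (Metric.ball (0 : E3) 1) ^ (2 / 3 : ℝ)) * ∫⁻ y, f y := by
  have h32 : (3 / 2 : ℝ≥0∞).toReal = 3 / 2 := by simp
  rw [eLpNorm_eq_lintegral_rpow_enorm_toReal (by norm_num) (by norm_num [ENNReal.div_eq_top]), h32]
  have h1 : ∫⁻ x in B, ‖T x‖ₑ ^ (3 / 2 : ℝ) ≤ c ^ (3 / 2 : ℝ) *
      (volume (Metric.ball (0 : E3) R) * (∫⁻ y, f y) ^ (3 / 2 : ℝ)) := by
    calc _ ≤ ∫⁻ x in B, c ^ (3 / 2 : ℝ) * (∫⁻ y in Metric.ball x R, f y) ^ (3 / 2 : ℝ) := by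
          refine setLIntegral_mono' hB fun x hx => ?_
          rw [← ENNReal.mul_rpow_of_nonneg _ _ (by norm_num)]
          exact ENNReal.rpow_le_rpow (h x hx) (by norm_num)
      _ ≤ ∫⁻ x, c ^ (3 / 2 : ℝ) * (∫⁻ y in Metric.ball x R, f y) ^ (3 / 2 : ℝ) :=
          setLIntegral_le_lintegral _ _
      _ ≤ _ := by
          rw [lintegral_const_mul' _ _ (ENNReal.rpow_ne_top_of_nonneg (by norm_num) hc)]
          exact mul_le_mul_right (rpow_three_halves_lintegral_ball_le hf R) _
  refine (ENNReal.rpow_le_rpow h1 (by norm_num)).trans (le_of_eq ?_)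
  rw [ENNReal.mul_rpow_of_nonneg _ _ (by norm_num), ENNReal.mul_rpow_of_nonneg _ _ (by norm_num),
    ← ENNReal.rpow_mul, ← ENNReal.rpow_mul, volume_ball_E3 0 hR,
    ENNReal.mul_rpow_of_nonneg _ _ (by norm_num), ENNReal.ofReal_rpow_of_nonneg (by positivity)
    (by norm_num), ← Real.rpow_natCast, ← Real.rpow_mul hR.le]
  norm_num
  ring

end Kernel

end NavierStokes

/-! ### Summation over dyadic scales and the estimate on a time slice. -/

namespace NavierStokes

/-- Dropping the first term replaces `(A, B)` by `(2A, B/2)` and preserves `AB`, so induction on `N`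
applies. The `-A` in the second bound absorbs the dropped term. The first bound takes over once the
crossing `B < 4A` is reached. -/
theorem sum_min_geometric_le (N : ℕ) : ∀ {A B : ℝ}, 0 ≤ A → 0 ≤ B →
    ∑ k ∈ Finset.range N, min (A * 2 ^ k) (B / 2 ^ k) ≤ 2 * B ∧
    (A ≤ B → ∑ k ∈ Finset.range N, min (A * 2 ^ k) (B / 2 ^ k) ≤ 4 * √(A * B) - A) := by
  induction N with
  | zero =>
    intro A B hA hB
    refine ⟨by simpa using hB, fun hAB => ?_⟩
    have : A ≤ √(A * B) := Real.le_sqrt_of_sq_le (by nlinarith)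
    simp
    linarith
  | succ N ih =>
    intro A B hA hB
    have e : ∑ k ∈ Finset.range (N + 1), min (A * 2 ^ k) (B / 2 ^ k) =
        (∑ k ∈ Finset.range N, min (2 * A * 2 ^ k) (B / 2 / 2 ^ k)) + min A B := by
      rw [Finset.sum_range_succ']
      simp only [pow_zero, mul_one, div_one]
      congr 1
      refine Finset.sum_congr rfl fun k _ => ?_
      rw [pow_succ]
      congr 1
      · ring
      · field_simp
    obtain ⟨h1, h2⟩ := ih (A := 2 * A) (B := B / 2) (by linarith) (by linarith)
    rw [e]
    refine ⟨by linarith [min_le_right A B], fun hAB => ?_⟩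
    have hm := min_le_left A B
    by_cases hc : 2 * A ≤ B / 2
    · have h3 := h2 hc
      rw [show 2 * A * (B / 2) = A * B by ring] at h3
      linarith
    · push Not at hc
      have hr := Real.sqrt_nonneg (A * B)
      have hr2 := Real.sq_sqrt (mul_nonneg hA hB)
      have hA0 : 0 < A := by linarith
      have l1 : A ≤ √(A * B) := Real.le_sqrt_of_sq_le (by nlinarith)
      have l2 : √(A * B) ≤ 2 * A := Real.sqrt_le_iff.2 ⟨by linarith, by nlinarith⟩
      -- With `R = √(AB)` between `A` and `2A`, `(R - A)(2A - R) ≥ 0` gives `2A² + R² ≤ 3AR`.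
      have l3 : A * (2 * A + B) ≤ A * (4 * √(A * B)) := by nlinarith
      have l4 := le_of_mul_le_mul_left l3 hA0
      linarith

theorem sum_min_geometric_le_sqrt (N : ℕ) {A B : ℝ} (hA : 0 ≤ A) (hB : 0 ≤ B) :
    ∑ k ∈ Finset.range N, min (A * 2 ^ k) (B / 2 ^ k) ≤ 4 * √(A * B) := by
  obtain ⟨h1, h2⟩ := sum_min_geometric_le N hA hB
  rcases le_total A B with h | h
  · linarith [h2 h]
  · have : B ≤ √(A * B) := Real.le_sqrt_of_sq_le (by nlinarith)
    linarith [Real.sqrt_nonneg (A * B)]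

/-- The convolution of `Q` with `s⁻³ η(· / s)`. -/
noncomputable def average (η : E3 → ℝ) (s : ℝ) (Q : E3 → ℝ) (x : E3) : ℝ :=
  ∫ y, Q y * (s⁻¹ ^ 3 * η (s⁻¹ • (x - y)))

section

variable {η : E3 → ℝ} {M : ℝ}

theorem hasCompactSupport_scaled (hηs : ∀ x, 1 < ‖x‖ → η x = 0) {s : ℝ} (hs : 0 < s) :
    HasCompactSupport fun x => s⁻¹ ^ 3 * η (s⁻¹ • x) := by
  refine HasCompactSupport.intro (isCompact_closedBall 0 s) fun x hx => ?_
  rw [hηs, mul_zero]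
  rw [norm_smul, norm_inv, Real.norm_of_nonneg hs.le, inv_mul_eq_div, one_lt_div hs]
  simpa using hx

open scoped Convolution in
theorem continuous_average (hη : Continuous η) (hηs : ∀ x, 1 < ‖x‖ → η x = 0) {s : ℝ}
    (hs : 0 < s) {Q : E3 → ℝ} (hQ : Integrable Q) : Continuous (average η s Q) := by
  have h := (hasCompactSupport_scaled hηs hs).continuous_convolution_right
    (ContinuousLinearMap.lsmul ℝ ℝ) (μ := volume) hQ.locallyIntegrable (by fun_prop)
  convert h using 1
  funext x
  simp [average, convolution_def]

theorem integrable_average_integrand (hη : Continuous η) (hηM : ∀ x, |η x| ≤ M) (s : ℝ)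
    {Q : E3 → ℝ} (hQ : Integrable Q) (x : E3) :
    Integrable fun y => Q y * (s⁻¹ ^ 3 * η (s⁻¹ • (x - y))) := by
  refine hQ.mul_bdd (c := |s⁻¹ ^ 3| * M) (by fun_prop) (Filter.Eventually.of_forall fun y => ?_)
  rw [Real.norm_eq_abs, abs_mul]
  gcongr
  exact hηM _

theorem enorm_average_le (hηM : ∀ x, |η x| ≤ M) {s : ℝ} (hs : 0 < s) (Q : E3 → ℝ) (x : E3) :
    ‖average η s Q x‖ₑ ≤ ENNReal.ofReal (s⁻¹ ^ 3 * M) * ∫⁻ y, ‖Q y‖ₑ := by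
  refine (enorm_integral_le_lintegral_enorm _).trans ?_
  rw [← lintegral_const_mul' _ _ ENNReal.ofReal_ne_top]
  refine lintegral_mono fun y => ?_
  rw [enorm_mul, mul_comm]
  gcongr
  rw [← ofReal_norm, Real.norm_eq_abs, abs_mul, abs_of_pos (by positivity)]
  gcongr
  exact hηM _

theorem integral_scaled (s : ℝ) (hs : 0 < s) (x : E3) :
    ∫ y, s⁻¹ ^ 3 * η (s⁻¹ • (x - y)) = ∫ y, η y := by
  rw [integral_const_mul, integral_sub_left_eq_self (fun y => η (s⁻¹ • y)) volume x,
    Measure.integral_comp_smul]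
  simp only [finrank_euclideanSpace, Fintype.card_fin, smul_eq_mul]
  rw [abs_of_pos (by positivity), ← mul_assoc, mul_inv_cancel₀ (by positivity), one_mul]

/-- No sign of `η` is used. After division by its integral, the kernels have mass one and are
dominated by a fixed multiple of the normalised indicator of a shrinking ball, so Lebesgue points
suffice. -/
theorem ae_tendsto_average (hηM : ∀ x, |η x| ≤ M)
    (hηs : ∀ x, 1 < ‖x‖ → η x = 0) (hη0 : ∫ x, η x ≠ 0) {s : ℕ → ℝ} (hs : ∀ n, 0 < s n)
    (hs0 : Filter.Tendsto s Filter.atTop (nhds 0)) {Q : E3 → ℝ} (hQ : Integrable Q) :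
    ∀ᵐ x, Filter.Tendsto (fun n => average η (s n) Q x) Filter.atTop
      (nhds ((∫ x, η x) * Q x)) := by
  set c := ∫ x, η x
  have hM : 0 ≤ M := (abs_nonneg _).trans (hηM 0)
  filter_upwards [(Besicovitch.vitaliFamily volume).ae_tendsto_average_norm_sub
    hQ.locallyIntegrable] with x hx
  have hs' : Filter.Tendsto s Filter.atTop (nhdsWithin 0 (Ioi 0)) :=
    tendsto_nhdsWithin_iff.2 ⟨hs0, Filter.Eventually.of_forall hs⟩
  have h1 := (hx.comp (Besicovitch.tendsto_filterAt volume x)).comp hs'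
  have h2 := tendsto_integral_smul_of_tendsto_average_norm_sub
    (g := fun n y => c⁻¹ * ((s n)⁻¹ ^ 3 * η ((s n)⁻¹ • (x - y))))
    (|c⁻¹| * M * volume.real (Metric.ball (0 : E3) 1)) h1 ?_ ?_ ?_ ?_
  · have h3 := h2.const_mul c
    refine h3.congr fun n => ?_
    rw [average, ← integral_const_mul]
    congr 1
    funext y
    rw [smul_eq_mul]
    field_simp
  · exact Filter.Eventually.of_forall fun n => hQ.integrableOn
  · refine tendsto_const_nhds.congr fun n => ?_
    rw [integral_const_mul, integral_scaled (s n) (hs n), inv_mul_cancel₀ hη0]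
  · refine Filter.Eventually.of_forall fun n y hy => ?_
    by_contra hcon
    refine hy ?_
    simp only
    rw [hηs, mul_zero, mul_zero]
    rw [norm_smul, norm_inv, Real.norm_of_nonneg (hs n).le, inv_mul_eq_div, one_lt_div (hs n)]
    rw [Metric.mem_closedBall, dist_comm, dist_eq_norm, not_le] at hcon
    exact hcon
  · refine Filter.Eventually.of_forall fun n y => ?_
    have hv : volume.real (Metric.closedBall x (s n)) =
        s n ^ 3 * volume.real (Metric.ball (0 : E3) 1) := by
      rw [Measure.addHaar_real_closedBall _ _ (hs n).le]
      simp
    have hκ : 0 < volume.real (Metric.ball (0 : E3) 1) :=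
      ENNReal.toReal_pos (Metric.measure_ball_pos _ _ one_pos).ne' measure_ball_lt_top.ne
    have hsn := hs n
    simp only
    rw [hv, abs_mul, abs_mul, abs_of_pos (by positivity : 0 < (s n)⁻¹ ^ 3)]
    calc |c⁻¹| * ((s n)⁻¹ ^ 3 * |η ((s n)⁻¹ • (x - y))|) ≤ |c⁻¹| * ((s n)⁻¹ ^ 3 * M) := by
          gcongr
          exact hηM _
      _ = _ := by field_simp

end

theorem sum_pd_pd_rescale {Θ η : E3 → ℝ} (hΘ : ContDiff ℝ (⊤ : ℕ∞) Θ)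
    (hΔ : ∀ x, ∑ i, pd i (pd i Θ) x = η x - 8 * η ((2 : ℝ) • x)) (s : ℝ) (x y : E3) :
    ∑ i, pd i (pd i (fun y => rescale s Θ (x - y))) y =
      s⁻¹ ^ 3 * η (s⁻¹ • (x - y)) - (s / 2)⁻¹ ^ 3 * η ((s / 2)⁻¹ • (x - y)) := by
  simp_rw [pd_pd_comp_const_sub (contDiff_rescale hΘ s), pd_pd_rescale hΘ, ← Finset.mul_sum, hΔ]
  rw [smul_smul, show (s / 2)⁻¹ = 2 * s⁻¹ by rw [inv_div]; ring]
  ring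

/-- The identity behind the telescoping: pairing with the Laplacian of the kernel at scale `s` is
the step between two consecutive averages. -/
theorem setIntegral_mul_laplacian_rescale {Θ η : E3 → ℝ} {M : ℝ} (hΘ : ContDiff ℝ (⊤ : ℕ∞) Θ)
    (hη : Continuous η) (hηM : ∀ x, |η x| ≤ M)
    (hΔ : ∀ x, ∑ i, pd i (pd i Θ) x = η x - 8 * η ((2 : ℝ) • x)) (s : ℝ) {W : Set E3}
    (hW : MeasurableSet W) {q : E3 → ℝ} (hq : IntegrableOn q W) (x : E3) :
    ∫ y in W, q y * ∑ i, pd i (pd i (fun y => rescale s Θ (x - y))) y =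
      average η s (W.indicator q) x - average η (s / 2) (W.indicator q) x := by
  have hQ : Integrable (W.indicator q) := (integrable_indicator_iff hW).2 hq
  rw [average, average, ← integral_sub (integrable_average_integrand hη hηM s hQ x)
    (integrable_average_integrand hη hηM (s / 2) hQ x), ← integral_indicator hW]
  congr 1
  funext y
  by_cases hy : y ∈ W
  · rw [indicator_of_mem hy, indicator_of_mem hy, sum_pd_pd_rescale hΘ hΔ]
    ring
  · rw [indicator_of_notMem hy, indicator_of_notMem hy]
    ring

/-- A spatial slice of the velocity, its gradient and the pressure on the ball `W`. -/
structure IsSlice (W : Set E3) (v : E3 → E3) (g : E3 → M3) (q : E3 → ℝ) : Prop where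
  velocity_memLp : MemLp v 2 (volume.restrict W)
  gradient_memLp : MemLp g 2 (volume.restrict W)
  pressure_integrable : IntegrableOn q W
  weakPartials : ∀ i, HasWeakPartials W (fun y => v y i) (fun j y => g y (i, j))
  divergence_free : ∀ φ : E3 → ℝ, IsTestFunction W φ → ∫ x in W, ∑ i, v x i * pd i φ x = 0

theorem exists_measurable_enorm {F : Type*} [NormedAddCommGroup F] {W : Set E3}
    {f : E3 → F} (hf : AEStronglyMeasurable f (volume.restrict W)) :
    ∃ γ : E3 → ℝ≥0∞, Measurable γ ∧ ∀ᵐ y ∂(volume.restrict W), ‖f y‖ₑ = γ y :=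
  ⟨hf.enorm.mk _, hf.enorm.measurable_mk, hf.enorm.ae_eq_mk⟩

/-- The two pointwise bounds are integrated over `B` with `R = 2s` and `R = 4s`. They yield
constants `36M` and `31104 · 16 M = 497664M`; the smaller is raised so that both share one constant.
-/
theorem eLpNorm_increment_le {Θ : E3 → ℝ} {M : ℝ} (hΘ : ContDiff ℝ (⊤ : ℕ∞) Θ)
    (hΘs : ∀ x, 1 < ‖x‖ → Θ x = 0) (hM : ∀ i j x, |pd j (pd i Θ) x| ≤ M) {s : ℝ} (hs : 0 < s)
    {W B : Set E3} (hWm : MeasurableSet W) (hW : volume W ≠ ⊤) (hB : MeasurableSet B)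
    (hball : ∀ x ∈ B, Metric.ball x (4 * s) ⊆ W) {v : E3 → E3} {g : E3 → M3} {q : E3 → ℝ}
    (hsl : IsSlice W v g q) {T : E3 → ℝ}
    (hT : ∀ x ∈ B, T x = doubleDiv W v (fun y => rescale s Θ (x - y))) :
    eLpNorm T (3 / 2) (volume.restrict B) ≤ volume (Metric.ball (0 : E3) 1) ^ (2 / 3 : ℝ) *
      min (ENNReal.ofReal (497664 * M * s⁻¹) * ∫⁻ y in W, ‖v y‖ₑ ^ 2)
        (ENNReal.ofReal (497664 * M * s) * ∫⁻ y in W, ‖g y‖ₑ ^ 2) := by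
  have hM0 : 0 ≤ M := (abs_nonneg _).trans (hM 0 0 0)
  obtain ⟨ν, hνm, hν⟩ := exists_measurable_enorm hsl.velocity_memLp.aestronglyMeasurable
  obtain ⟨γ, hγm, hγ⟩ := exists_measurable_enorm hsl.gradient_memLp.aestronglyMeasurable
  have aux : ∀ (f : E3 → ℝ≥0∞) (x : E3) (R : ℝ), Metric.ball x R ⊆ W →
      ∫⁻ y in Metric.ball x R, f y = ∫⁻ y in Metric.ball x R, W.indicator f y := by
    intro f x R hR
    refine setLIntegral_congr_fun Metric.isOpen_ball.measurableSet fun y hy => ?_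
    rw [indicator_of_mem (hR hy)]
  set κ := volume (Metric.ball (0 : E3) 1) ^ (2 / 3 : ℝ)
  rw [mul_min]
  refine le_min ?_ ?_
  · have h1 := eLpNorm_three_halves_le_of_ball (T := T) (f := W.indicator fun y => ν y ^ 2)
      ((hνm.pow_const 2).indicator hWm) (R := 2 * s) (by positivity)
      (c := ENNReal.ofReal (9 * (s⁻¹ ^ 3 * M))) ENNReal.ofReal_ne_top hB (by
        intro x hx
        have hsub : Metric.ball x (2 * s) ⊆ W :=
          (Metric.ball_subset_ball (by linarith)).trans (hball x hx)
        rw [hT x hx, ← aux _ x _ hsub]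
        refine (enorm_doubleDiv_rescale_le hΘ hΘs hM hs x W v).trans (le_of_eq ?_)
        congr 1
        refine lintegral_congr_ae ?_
        filter_upwards [ae_restrict_of_ae_restrict_of_subset hsub hν] with y hy
        rw [hy])
    refine h1.trans ?_
    rw [lintegral_indicator hWm]
    have e : ∫⁻ y in W, ν y ^ 2 = ∫⁻ y in W, ‖v y‖ₑ ^ 2 := by
      refine lintegral_congr_ae ?_
      filter_upwards [hν] with y hy
      rw [hy]
    have h2 : ENNReal.ofReal (9 * (s⁻¹ ^ 3 * M)) * ENNReal.ofReal ((2 * s) ^ 2) ≤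
        ENNReal.ofReal (497664 * M * s⁻¹) := by
      rw [← ENNReal.ofReal_mul (by positivity)]
      refine ENNReal.ofReal_le_ofReal ?_
      have : 9 * (s⁻¹ ^ 3 * M) * (2 * s) ^ 2 = 36 * M * s⁻¹ := by
        field_simp
        ring
      rw [this]
      gcongr
      norm_num
    calc _ = κ * (ENNReal.ofReal (9 * (s⁻¹ ^ 3 * M)) * ENNReal.ofReal ((2 * s) ^ 2) *
          ∫⁻ y in W, ‖v y‖ₑ ^ 2) := by rw [e]; ring
      _ ≤ _ := mul_le_mul_right (mul_le_mul_left h2 _) _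
  · have h1 := eLpNorm_three_halves_le_of_ball (T := T) (f := W.indicator fun y => γ y ^ 2)
      ((hγm.pow_const 2).indicator hWm) (R := 4 * s) (by positivity)
      (c := ENNReal.ofReal (31104 * (s⁻¹ * M))) ENNReal.ofReal_ne_top hB (by
        intro x hx
        rw [hT x hx, ← aux _ x _ (hball x hx)]
        exact enorm_doubleDiv_rescale_le_gradient hΘ hΘs hM hs hWm hW (hball x hx)
          hsl.velocity_memLp hsl.divergence_free hsl.weakPartials hγm (hγ.mono fun y hy => hy.le))
    refine h1.trans (le_of_eq ?_)
    rw [lintegral_indicator hWm]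
    have e : ∫⁻ y in W, γ y ^ 2 = ∫⁻ y in W, ‖g y‖ₑ ^ 2 := by
      refine lintegral_congr_ae ?_
      filter_upwards [hγ] with y hy
      rw [hy]
    have h2 : ENNReal.ofReal (31104 * (s⁻¹ * M)) * ENNReal.ofReal ((4 * s) ^ 2) =
        ENNReal.ofReal (497664 * M * s) := by
      rw [← ENNReal.ofReal_mul (by positivity)]
      congr 1
      field_simp
      ring
    rw [e, ← h2]
    ring

/-- The product of the two prefactors is `L²ab`, so the initial scale `σ` drops out. -/
theorem sum_min_ofReal_le (N : ℕ) {L σ : ℝ} (hL : 0 ≤ L) (hσ : 0 < σ) {a b : ℝ≥0∞} (ha : a ≠ ⊤)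
    (hb : b ≠ ⊤) : ∑ k ∈ Finset.range N, min (ENNReal.ofReal (L * (σ / 2 ^ k)⁻¹) * a)
      (ENNReal.ofReal (L * (σ / 2 ^ k)) * b) ≤ ENNReal.ofReal (4 * L) * (a * b) ^ (1 / 2 : ℝ) := by
  lift a to NNReal using ha
  lift b to NNReal using hb
  have e : ∀ k, min (ENNReal.ofReal (L * (σ / 2 ^ k)⁻¹) * (a : ℝ≥0∞))
      (ENNReal.ofReal (L * (σ / 2 ^ k)) * b) =
      ENNReal.ofReal (min ((L * σ⁻¹ * a) * 2 ^ k) ((L * σ * b) / 2 ^ k)) := by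
    intro k
    rw [← ENNReal.ofReal_coe_nnreal (p := a), ← ENNReal.ofReal_coe_nnreal (p := b),
      ← ENNReal.ofReal_mul (by positivity), ← ENNReal.ofReal_mul (by positivity),
      ← ENNReal.ofReal_min]
    congr 2
    · rw [inv_div]; field_simp
    · ring
  simp_rw [e]
  rw [← ENNReal.ofReal_sum_of_nonneg fun k _ => by positivity]
  refine (ENNReal.ofReal_le_ofReal (sum_min_geometric_le_sqrt N (by positivity)
    (by positivity))).trans (le_of_eq ?_)
  have e2 : L * σ⁻¹ * a * (L * σ * b) = L ^ 2 * (a * b) := by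
    field_simp
  rw [e2, Real.sqrt_mul (by positivity), Real.sqrt_sq hL, ← mul_assoc,
    ENNReal.ofReal_mul (by positivity), Real.sqrt_eq_rpow, ← ENNReal.ofReal_rpow_of_nonneg
    (by positivity) (by norm_num), ENNReal.ofReal_mul (by positivity)]
  simp

theorem volume_ball_rpow (z : E3) {r : ℝ} (hr : 0 < r) {e : ℝ} (he : 0 ≤ e) :
    volume (Metric.ball z r) ^ e =
      ENNReal.ofReal (r ^ (3 * e)) * volume (Metric.ball (0 : E3) 1) ^ e := by
  rw [volume_ball_E3 z hr, ENNReal.mul_rpow_of_nonneg _ _ he,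
    ENNReal.ofReal_rpow_of_nonneg (by positivity) he, ← Real.rpow_natCast, ← Real.rpow_mul hr.le]
  simp

/-- Hölder from `L^{6/5}` to `L¹` on the `ρ`-ball costs `ρ^{1/2}`, the kernel is at most `512 M
ρ⁻³`, and the `L^{3/2}` norm of a constant on the `r`-ball costs `r²`. -/
theorem eLpNorm_average_le {η : E3 → ℝ} {M : ℝ} (hηM : ∀ x, |η x| ≤ M) {x₀ : E3} {ρ r : ℝ}
    (hρ : 0 < ρ) (hr : 0 < r) {q : E3 → ℝ} (hq : IntegrableOn q (Metric.ball x₀ ρ)) :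
    eLpNorm (average η (ρ / 8) ((Metric.ball x₀ ρ).indicator q)) (3 / 2)
      (volume.restrict (Metric.ball x₀ r)) ≤
      ENNReal.ofReal (512 * M) * volume (Metric.ball (0 : E3) 1) ^ (1 / 6 : ℝ) *
        volume (Metric.ball (0 : E3) 1) ^ (2 / 3 : ℝ) * (ENNReal.ofReal (r ^ 2 * ρ ^ (-(5 / 2) : ℝ)) *
        eLpNorm q (6 / 5) (volume.restrict (Metric.ball x₀ ρ))) := by
  have hM0 : 0 ≤ M := (abs_nonneg _).trans (hηM 0)
  have hW : MeasurableSet (Metric.ball x₀ ρ) := Metric.isOpen_ball.measurableSet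
  set κ := volume (Metric.ball (0 : E3) 1)
  have h1 : ∫⁻ y, ‖(Metric.ball x₀ ρ).indicator q y‖ₑ ≤
      eLpNorm q (6 / 5) (volume.restrict (Metric.ball x₀ ρ)) *
        (ENNReal.ofReal (ρ ^ (1 / 2 : ℝ)) * κ ^ (1 / 6 : ℝ)) := by
    have h65 : (1 : ℝ≥0∞) ≤ 6 / 5 := by
      rw [ENNReal.le_div_iff_mul_le (by norm_num) (by norm_num)]
      norm_num
    have h := eLpNorm_le_eLpNorm_mul_rpow_measure_univ h65 hq.aestronglyMeasurable
    rw [eLpNorm_one_eq_lintegral_enorm, Measure.restrict_apply_univ,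
      show 1 / (1 : ℝ≥0∞).toReal - 1 / (6 / 5 : ℝ≥0∞).toReal = 1 / 6 by simp; norm_num,
      volume_ball_rpow x₀ hρ (by norm_num), show (3 : ℝ) * (1 / 6) = 1 / 2 by norm_num] at h
    simp_rw [enorm_indicator_eq_indicator_enorm]
    rw [lintegral_indicator hW]
    exact h
  have h2 := eLpNorm_le_of_ae_enorm_bound (p := 3 / 2)
    (μ := volume.restrict (Metric.ball x₀ r)) (f := average η (ρ / 8) ((Metric.ball x₀ ρ).indicator q))
    (Filter.Eventually.of_forall fun x =>
      (enorm_average_le hηM (by positivity : 0 < ρ / 8) ((Metric.ball x₀ ρ).indicator q) x).trans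
        (mul_le_mul_right h1 _))
  refine h2.trans (le_of_eq ?_)
  rw [Measure.restrict_apply_univ, smul_eq_mul, show (3 / 2 : ℝ≥0∞).toReal⁻¹ = 2 / 3 by simp,
    volume_ball_rpow x₀ hr (by norm_num), show (3 : ℝ) * (2 / 3) = ((2 : ℕ) : ℝ) by norm_num,
    Real.rpow_natCast]
  have e : ENNReal.ofReal ((ρ / 8)⁻¹ ^ 3 * M) * ENNReal.ofReal (ρ ^ (1 / 2 : ℝ)) *
      ENNReal.ofReal (r ^ 2) = ENNReal.ofReal (512 * M) *
      ENNReal.ofReal (r ^ 2 * ρ ^ (-(5 / 2) : ℝ)) := by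
    rw [← ENNReal.ofReal_mul (by positivity), ← ENNReal.ofReal_mul (by positivity),
      ← ENNReal.ofReal_mul (by positivity)]
    congr 1
    have e1 : ρ ^ (1 / 2 : ℝ) = ρ ^ 3 * ρ ^ (-(5 / 2) : ℝ) := by
      rw [← Real.rpow_natCast, ← Real.rpow_add hρ]
      norm_num
    rw [e1]
    field_simp
    ring
  calc _ = (ENNReal.ofReal ((ρ / 8)⁻¹ ^ 3 * M) * ENNReal.ofReal (ρ ^ (1 / 2 : ℝ)) *
      ENNReal.ofReal (r ^ 2)) * κ ^ (1 / 6 : ℝ) * κ ^ (2 / 3 : ℝ) *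
        eLpNorm q (6 / 5) (volume.restrict (Metric.ball x₀ ρ)) := by ring
    _ = _ := by rw [e]; ring

/-- The local estimate of the pressure on a time slice. -/
theorem exists_slice_estimate : ∃ Θ : E3 → ℝ, ContDiff ℝ (⊤ : ℕ∞) Θ ∧ (∀ x, 1 < ‖x‖ → Θ x = 0) ∧
    ∃ C : ℝ≥0∞, C ≠ ⊤ ∧ ∀ (x₀ : E3) (ρ : ℝ), 0 < ρ → ∀ (v : E3 → E3) (g : E3 → M3) (q : E3 → ℝ),
      IsSlice (Metric.ball x₀ ρ) v g q →
      (∀ k : ℕ, ∀ x ∈ Metric.ball x₀ (ρ / 4),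
        doubleDiv (Metric.ball x₀ ρ) v (fun y => rescale (ρ / 8 / 2 ^ k) Θ (x - y)) =
        - ∫ y in Metric.ball x₀ ρ,
          q y * ∑ i, pd i (pd i (fun y => rescale (ρ / 8 / 2 ^ k) Θ (x - y))) y) →
      ∀ r, 0 < r → r ≤ ρ / 4 → eLpNorm q (3 / 2) (volume.restrict (Metric.ball x₀ r)) ≤
        C * (((∫⁻ y in Metric.ball x₀ ρ, ‖v y‖ₑ ^ 2) *
            ∫⁻ y in Metric.ball x₀ ρ, ‖g y‖ₑ ^ 2) ^ (1 / 2 : ℝ) +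
          ENNReal.ofReal (r ^ 2 * ρ ^ (-(5 / 2) : ℝ)) *
            eLpNorm q (6 / 5) (volume.restrict (Metric.ball x₀ ρ))) := by
  obtain ⟨Θ, η, hΘ, hΘs, hη, hηs, hη0, hΔ⟩ := exists_dyadic_kernel
  obtain ⟨M₁, hM₁⟩ := exists_bound_pd_pd hΘ hΘs
  obtain ⟨M₂, hM₂⟩ := HasCompactSupport.exists_bound_of_continuous (f := η)
    (HasCompactSupport.intro (isCompact_closedBall 0 1) fun x hx => hηs x (by simpa using hx)) hη
  have hM₁0 : 0 ≤ M₁ := (abs_nonneg _).trans (hM₁ 0 0 0)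
  set κ := volume (Metric.ball (0 : E3) 1)
  have hκ : κ ≠ ⊤ := measure_ball_lt_top.ne
  set c := ∫ x, η x
  set C₁ := κ ^ (2 / 3 : ℝ) * ENNReal.ofReal (4 * (497664 * M₁))
  set C₂ := ENNReal.ofReal (512 * M₂) * κ ^ (1 / 6 : ℝ) * κ ^ (2 / 3 : ℝ)
  have hc0 : ‖c‖ₑ ≠ 0 := enorm_ne_zero.2 hη0
  refine ⟨Θ, hΘ, hΘs, ‖c‖ₑ⁻¹ * (C₁ + C₂), ?_, ?_⟩
  · refine ENNReal.mul_ne_top (ENNReal.inv_ne_top.2 hc0) (ENNReal.add_ne_top.2 ⟨?_, ?_⟩)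
    · exact ENNReal.mul_ne_top (ENNReal.rpow_ne_top_of_nonneg (by norm_num) hκ)
        ENNReal.ofReal_ne_top
    · exact ENNReal.mul_ne_top (ENNReal.mul_ne_top ENNReal.ofReal_ne_top
        (ENNReal.rpow_ne_top_of_nonneg (by norm_num) hκ))
        (ENNReal.rpow_ne_top_of_nonneg (by norm_num) hκ)
  intro x₀ ρ hρ v g q hsl hpde r hr hrρ
  set W := Metric.ball x₀ ρ with hWdef
  have hW : MeasurableSet W := Metric.isOpen_ball.measurableSet
  have hB : MeasurableSet (Metric.ball x₀ r) := Metric.isOpen_ball.measurableSet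
  have hQ : Integrable (W.indicator q) := (integrable_indicator_iff hW).2 hsl.pressure_integrable
  set μ := volume.restrict (Metric.ball x₀ r)
  set a := ∫⁻ y in W, ‖v y‖ₑ ^ 2 with ha_def
  set b := ∫⁻ y in W, ‖g y‖ₑ ^ 2 with hb_def
  have hfin : ∀ {F : Type} [NormedAddCommGroup F] (f : E3 → F), MemLp f 2 (volume.restrict W) →
      ∫⁻ y in W, ‖f y‖ₑ ^ 2 ≠ ⊤ := by
    intro F _ f hf
    have := lintegral_rpow_enorm_lt_top_of_eLpNorm_lt_top (by norm_num) (by norm_num) hf.2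
    simpa using this.ne
  have ha : a ≠ ⊤ := hfin v hsl.velocity_memLp
  have hb : b ≠ ⊤ := hfin g hsl.gradient_memLp
  -- Starting at `ρ/8` keeps the `4s`-ball about any point of the `ρ/4`-ball inside `W`, since `ρ/4
  -- + ρ/2 < ρ`.
  let s : ℕ → ℝ := fun k => ρ / 8 / 2 ^ k
  have hs : ∀ k, 0 < s k := fun k => by positivity
  let P : ℕ → E3 → ℝ := fun k => average η (s k) (W.indicator q)
  have hPc : ∀ k, Continuous (P k) := fun k => continuous_average hη hηs (hs k) hQ
  have hPm : ∀ k, AEStronglyMeasurable (P k) μ := fun k => (hPc k).aestronglyMeasurable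
  have hinc : ∀ k, eLpNorm (P (k + 1) - P k) (3 / 2) μ ≤ κ ^ (2 / 3 : ℝ) *
      min (ENNReal.ofReal (497664 * M₁ * (s k)⁻¹) * a) (ENNReal.ofReal (497664 * M₁ * s k) * b) := by
    intro k
    refine eLpNorm_increment_le hΘ hΘs hM₁ (hs k) hW measure_ball_lt_top.ne hB ?_ hsl ?_
    · intro x hx
      refine Metric.ball_subset_ball' ?_
      have h1 := Metric.mem_ball.1 hx
      have h2 : s k ≤ ρ / 8 := div_le_self (by positivity) (one_le_pow₀ (by norm_num))
      linarith
    · intro x hx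
      rw [hpde k x (Metric.ball_subset_ball hrρ hx),
        setIntegral_mul_laplacian_rescale hΘ hη hM₂ hΔ _ hW hsl.pressure_integrable x]
      simp only [Pi.sub_apply, P, s, pow_succ]
      rw [div_div _ (2 ^ k) 2]
      ring
  have hP : ∀ N, eLpNorm (P N) (3 / 2) μ ≤ (C₁ + C₂) * ((a * b) ^ (1 / 2 : ℝ) +
      ENNReal.ofReal (r ^ 2 * ρ ^ (-(5 / 2) : ℝ)) * eLpNorm q (6 / 5) (volume.restrict W)) := by
    intro N
    have h32 : (1 : ℝ≥0∞) ≤ 3 / 2 := by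
      rw [ENNReal.le_div_iff_mul_le (by norm_num) (by norm_num)]
      norm_num
    have e : P N = P 0 + ∑ k ∈ Finset.range N, (P (k + 1) - P k) := by
      rw [Finset.sum_range_sub]
      abel
    have h0 : eLpNorm (P 0) (3 / 2) μ ≤ C₂ * (ENNReal.ofReal (r ^ 2 * ρ ^ (-(5 / 2) : ℝ)) *
        eLpNorm q (6 / 5) (volume.restrict W)) := by
      have h := eLpNorm_average_le hM₂ hρ hr hsl.pressure_integrable
      have e0 : P 0 = average η (ρ / 8) (W.indicator q) := by simp [P, s]
      rw [e0]
      exact h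
    have hS : ∑ k ∈ Finset.range N, eLpNorm (P (k + 1) - P k) (3 / 2) μ ≤
        C₁ * (a * b) ^ (1 / 2 : ℝ) := by
      refine (Finset.sum_le_sum fun k _ => hinc k).trans ?_
      rw [← Finset.mul_sum, mul_assoc]
      exact mul_le_mul_right (sum_min_ofReal_le N (by positivity) (by positivity) ha hb) _
    rw [e]
    refine (eLpNorm_add_le (hPm 0) (Finset.aestronglyMeasurable_sum _ fun k _ =>
      (hPm _).sub (hPm _)) h32).trans ?_
    refine (add_le_add h0 ((eLpNorm_sum_le (fun k _ => (hPm _).sub (hPm _)) h32).trans hS)).trans ?_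
    rw [mul_add, add_comm]
    gcongr
    · exact le_self_add
    · exact le_add_self
  have hs0 : Filter.Tendsto s Filter.atTop (nhds 0) :=
    Filter.Tendsto.const_div_atTop (tendsto_pow_atTop_atTop_of_one_lt (by norm_num)) _
  have hlim : ∀ᵐ x ∂μ, Filter.Tendsto (fun k => P k x) Filter.atTop (nhds ((c • q) x)) := by
    filter_upwards [ae_restrict_of_ae (ae_tendsto_average hM₂ hηs hη0 hs hs0 hQ), ae_restrict_mem hB]
      with x hx hxB
    have hxW : x ∈ W := Metric.ball_subset_ball (by linarith) hxB
    rwa [indicator_of_mem hxW] at hx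
  -- Lower semicontinuity of the norm under a.e. convergence passes the bound, uniform in `N`, to `c
  -- • q`. Dividing by `‖c‖ₑ` finishes.
  have hq := Lp.eLpNorm_le_of_ae_tendsto (u := Filter.atTop) (Filter.Eventually.of_forall hP) hPm hlim
  rw [eLpNorm_const_smul] at hq
  rw [mul_assoc, ← ENNReal.div_eq_inv_mul, ENNReal.le_div_iff_mul_le (Or.inl hc0)
    (Or.inl enorm_ne_top), mul_comm]
  exact hq

end NavierStokes

/-! ### The pressure equation on almost every time slice. -/

namespace NavierStokes

theorem memLp_slice {F : Type*} [NormedAddCommGroup F] {μ : Measure E3} {ν : Measure ℝ} [SFinite μ]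
    [SFinite ν] {f : E3 × ℝ → F} {p : ℝ≥0∞} (hp0 : p ≠ 0) (hp : p ≠ ⊤) (hf : MemLp f p (μ.prod ν)) :
    ∀ᵐ t ∂ν, MemLp (fun x => f (x, t)) p μ := by
  have h1 := (hf.integrable_norm_rpow hp0 hp).prod_left_ae
  filter_upwards [h1, hf.1.prodMk_right] with t ht hm
  exact (integrable_norm_rpow_iff hm hp0 hp).1 ht

theorem IsTestFunction.memLp {X : Type*} [NormedAddCommGroup X] [NormedSpace ℝ X]
    [MeasurableSpace X] [OpensMeasurableSpace X] {W : Set X} {φ : X → ℝ} (h : IsTestFunction W φ)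
    (μ : Measure X) [IsFiniteMeasureOnCompacts μ] (q : ℝ≥0∞) : MemLp φ q μ :=
  h.smooth.continuous.memLp_of_hasCompactSupport h.compact

theorem MemLp.integrable_mul_of_forall_memLp {α : Type*} [MeasurableSpace α] {μ : Measure α}
    {f g : α → ℝ} {p : ℝ≥0∞} (hp : 1 ≤ p) (hf : MemLp f p μ) (hg : ∀ q, MemLp g q μ) :
    Integrable (fun x => f x * g x) μ := by
  have := ENNReal.HolderConjugate.conjExponent hp
  exact hf.integrable_mul (hg p.conjExponent)

theorem contDiff_vector {X : Type*} [NormedAddCommGroup X] [NormedSpace ℝ X] {f : Fin 3 → X → ℝ}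
    (hf : ∀ i, ContDiff ℝ (⊤ : ℕ∞) (f i)) :
    ContDiff ℝ (⊤ : ℕ∞) fun x => (WithLp.toLp 2 fun i => f i x : E3) :=
  contDiff_euclidean.2 hf

theorem fderiv_vector_apply {X : Type*} [NormedAddCommGroup X] [NormedSpace ℝ X] {f : X → E3}
    (hf : Differentiable ℝ f) (z h : X) (i : Fin 3) :
    fderiv ℝ f z h i = fderiv ℝ (fun z => f z i) z h := by
  have h1 := (EuclideanSpace.proj i : E3 →L[ℝ] ℝ).hasFDerivAt.comp z (hf z).hasFDerivAt
  have h2 : fderiv ℝ (fun z => f z i) z = _ := h1.fderiv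
  rw [h2]
  simp

theorem fderiv_mul_prod {χ : ℝ → ℝ} {f : E3 → ℝ} (hχ : Differentiable ℝ χ) (hf : Differentiable ℝ f)
    (z : E3 × ℝ) (e : E3) (τ : ℝ) :
    fderiv ℝ (fun z : E3 × ℝ => χ z.2 * f z.1) z (e, τ) =
      deriv χ z.2 * τ * f z.1 + χ z.2 * fderiv ℝ f z.1 e := by
  have h1 : HasFDerivAt (fun z : E3 × ℝ => χ z.2)
      (deriv χ z.2 • ContinuousLinearMap.snd ℝ E3 ℝ) z :=
    (hχ z.2).hasDerivAt.comp_hasFDerivAt z hasFDerivAt_snd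
  have h2 : HasFDerivAt (fun z : E3 × ℝ => f z.1)
      ((fderiv ℝ f z.1).comp (ContinuousLinearMap.fst ℝ E3 ℝ)) z :=
    (hf z.1).hasFDerivAt.comp z hasFDerivAt_fst
  have h3 : fderiv ℝ (fun z : E3 × ℝ => χ z.2 * f z.1) z = _ := (h1.mul h2).fderiv
  rw [h3]
  simp
  ring

/-- The test field `χ(t) ∇φ(x)`. -/
noncomputable def gradientField (χ : ℝ → ℝ) (φ : E3 → ℝ) (z : E3 × ℝ) : E3 :=
  WithLp.toLp 2 fun i => χ z.2 * pd i φ z.1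

theorem isTestFunction_gradientField {Ω : Set E3} {φ : E3 → ℝ} (hφ : IsTestFunction Ω φ)
    {I : Set ℝ} {χ : ℝ → ℝ} (hχ : IsTestFunction I χ) :
    IsTestFunction (Ω ×ˢ I) (gradientField χ φ) := by
  have hz : ∀ z, z ∉ tsupport φ ×ˢ tsupport χ → gradientField χ φ z = 0 := by
    intro z hz
    ext i
    simp only [gradientField, PiLp.zero_apply]
    by_contra hcon
    obtain ⟨h1, h2⟩ := mul_ne_zero_iff.1 hcon
    have hφ' : IsTestFunction (tsupport φ) φ := ⟨hφ.smooth, hφ.compact, Subset.rfl⟩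
    exact hz ⟨(hφ'.pd i).support_subset (subset_tsupport _ h2), subset_tsupport _ h1⟩
  refine ⟨contDiff_vector fun i => ?_, HasCompactSupport.intro (hφ.compact.prod hχ.compact) hz, ?_⟩
  · exact (hχ.smooth.comp contDiff_snd).mul ((hφ.pd i).smooth.comp contDiff_fst)
  · refine (closure_minimal ?_ ((isClosed_tsupport φ).prod (isClosed_tsupport χ))).trans
      (prod_mono hφ.support_subset hχ.support_subset)
    intro z hz'
    by_contra hcon
    exact hz' (hz z hcon)

theorem differentiable_gradientField {Ω : Set E3} {φ : E3 → ℝ} (hφ : IsTestFunction Ω φ)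
    {I : Set ℝ} {χ : ℝ → ℝ} (hχ : IsTestFunction I χ) : Differentiable ℝ (gradientField χ φ) :=
  (isTestFunction_gradientField hφ hχ).smooth.differentiable (by simp)

theorem dt_gradientField {Ω : Set E3} {φ : E3 → ℝ} (hφ : IsTestFunction Ω φ)
    {I : Set ℝ} {χ : ℝ → ℝ} (hχ : IsTestFunction I χ) (z : E3 × ℝ) (i : Fin 3) :
    dt (gradientField χ φ) z i = deriv χ z.2 * pd i φ z.1 := by
  rw [dt, fderiv_vector_apply (differentiable_gradientField hφ hχ)]
  have := fderiv_mul_prod (hχ.smooth.differentiable (by simp))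
    ((hφ.pd i).smooth.differentiable (by simp)) z 0 1
  simp only [mul_one, map_zero, mul_zero, add_zero] at this
  exact this

theorem dx_gradientField {Ω : Set E3} {φ : E3 → ℝ} (hφ : IsTestFunction Ω φ)
    {I : Set ℝ} {χ : ℝ → ℝ} (hχ : IsTestFunction I χ) (z : E3 × ℝ) (i j : Fin 3) :
    dx j (gradientField χ φ) z i = χ z.2 * pd j (pd i φ) z.1 := by
  rw [dx, fderiv_vector_apply (differentiable_gradientField hφ hχ)]
  have := fderiv_mul_prod (hχ.smooth.differentiable (by simp))
    ((hφ.pd i).smooth.differentiable (by simp)) z (EuclideanSpace.single j 1) 0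
  simp only [mul_zero, zero_mul, zero_add] at this
  exact this

/-- The viscous term drops out: the weak gradient moves one derivative onto the Hessian, and
commuting derivatives leaves `v` paired with the gradients of the test functions `∂ⱼ∂ⱼφ`. -/
theorem integral_gradient_hessian_eq_zero {Ω : Set E3} {v : E3 → E3} {g : E3 → M3}
    (hv : MemLp v 2 (volume.restrict Ω)) (hg : MemLp g 2 (volume.restrict Ω))
    (hw : IsWeakGradient Ω v g)
    (hdiv : ∀ φ : E3 → ℝ, IsTestFunction Ω φ → ∫ x in Ω, ∑ i, v x i * pd i φ x = 0)
    {φ : E3 → ℝ} (hφ : IsTestFunction Ω φ) :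
    ∫ x in Ω, ∑ i, ∑ j, g x (i, j) * pd j (pd i φ) x = 0 := by
  have hgi : ∀ i j, MemLp (fun x => g x (i, j)) 2 (volume.restrict Ω) := fun i j =>
    hg.continuousLinearMap_comp (EuclideanSpace.proj (i, j) : M3 →L[ℝ] ℝ)
  have i1 : ∀ i j, Integrable (fun x => g x (i, j) * pd j (pd i φ) x) (volume.restrict Ω) :=
    fun i j => MemLp.integrable_mul_of_forall_memLp (by norm_num) (hgi i j)
      fun q => ((hφ.pd i).pd j).memLp _ q
  have i2 : ∀ i j, Integrable (fun x => v x i * pd i (pd j (pd j φ)) x) (volume.restrict Ω) :=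
    fun i j => MemLp.integrable_mul_of_forall_memLp (by norm_num) (memLp_coord hv i)
      fun q => (((hφ.pd j).pd j).pd i).memLp _ q
  rw [integral_finsetSum _ fun i _ => integrable_finsetSum _ fun j _ => i1 i j]
  simp_rw [integral_finsetSum Finset.univ fun j _ => i1 _ j]
  have e : ∀ i j, ∫ x in Ω, g x (i, j) * pd j (pd i φ) x =
      - ∫ x in Ω, v x i * pd i (pd j (pd j φ)) x := by
    intro i j
    have h := hw.integral_eq _ ((hφ.pd i).pd j) i j
    rw [eq_neg_iff_add_eq_zero, add_comm, ← eq_neg_iff_add_eq_zero, ← h]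
    congr 1
    funext x
    have e1 : pd j (pd i φ) = pd i (pd j φ) := funext fun x => pd_comm hφ.smooth j i x
    change v x i * pd i (pd j (pd j φ)) x = v x i * pd j (pd j (pd i φ)) x
    rw [e1, pd_comm (hφ.pd j).smooth j i x]
  simp_rw [e]
  rw [Finset.sum_comm]
  simp_rw [Finset.sum_neg_distrib]
  rw [neg_eq_zero]
  refine Finset.sum_eq_zero fun j _ => ?_
  rw [← integral_finsetSum _ fun i _ => i2 i j]
  exact hdiv _ ((hφ.pd j).pd j)

/-- Test the momentum equation with `χ(t)∇φ(x)`. The time-derivative and viscous terms vanish by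
incompressibility, and since `χ` is arbitrary the remaining slice integral vanishes for a.e. `t`.
The exceptional set depends on `φ`. -/
theorem IsSuitableWeakSolution.ae_pressure_equation {Ω : Set E3} {a b : ℝ} {u : E3 × ℝ → E3}
    {G : E3 × ℝ → M3} {p : E3 × ℝ → ℝ} (h : IsSuitableWeakSolution Ω a b u G p)
    {φ : E3 → ℝ} (hφ : IsTestFunction Ω φ) :
    ∀ᵐ t ∂(volume.restrict (Ioo a b)),
      ∫ x in Ω, ((∑ i, ∑ j, u (x, t) i * u (x, t) j * pd j (pd i φ) x) +
        p (x, t) * ∑ i, pd i (pd i φ) x) = 0 := by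
  set μ : Measure E3 := volume.restrict Ω
  set ν : Measure ℝ := volume.restrict (Ioo a b)
  have hprod : volume.restrict (Ω ×ˢ Ioo a b) = μ.prod ν := by
    rw [Measure.prod_restrict, Measure.volume_eq_prod]
  have hu : MemLp u 2 (μ.prod ν) := hprod ▸ h.velocity_L2
  have hG : MemLp G 2 (μ.prod ν) := hprod ▸ h.gradient_L2
  have hp : MemLp p (3 / 2) (μ.prod ν) := hprod ▸ h.pressure_mem
  have h32 : (1 : ℝ≥0∞) ≤ 3 / 2 := by
    rw [ENNReal.le_div_iff_mul_le (by norm_num) (by norm_num)]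
    norm_num
  have htest : ∀ f : E3 → ℝ, IsTestFunction Ω f → ∀ q, MemLp (fun z : E3 × ℝ => f z.1) q (μ.prod ν) :=
    fun f hf q => (hf.memLp μ q).comp_fst ν
  let A : E3 × ℝ → ℝ := fun z => ∑ i, u z i * pd i φ z.1
  let B : E3 × ℝ → ℝ := fun z => ∑ i, ∑ j, G z (i, j) * pd j (pd i φ) z.1
  let H : E3 × ℝ → ℝ := fun z => (∑ i, ∑ j, u z i * u z j * pd j (pd i φ) z.1) +
    p z * ∑ i, pd i (pd i φ) z.1
  have hA : Integrable A (μ.prod ν) := integrable_finsetSum _ fun i _ =>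
    MemLp.integrable_mul_of_forall_memLp (by norm_num) (memLp_coord hu i) (htest _ (hφ.pd i))
  have hB : Integrable B (μ.prod ν) := integrable_finsetSum _ fun i _ =>
    integrable_finsetSum _ fun j _ => MemLp.integrable_mul_of_forall_memLp (by norm_num)
      (hG.continuousLinearMap_comp (EuclideanSpace.proj (i, j) : M3 →L[ℝ] ℝ))
      (htest _ ((hφ.pd i).pd j))
  have hH : Integrable H (μ.prod ν) := by
    refine Integrable.add (integrable_finsetSum _ fun i _ => integrable_finsetSum _ fun j _ => ?_) ?_
    · exact MemLp.integrable_mul_of_forall_memLp le_rfl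
        (memLp_one_iff_integrable.2 (integrable_coord_mul_coord hu i j)) (htest _ ((hφ.pd i).pd j))
    · exact MemLp.integrable_mul_of_forall_memLp h32 hp fun q =>
        memLp_finsetSum _ fun i _ => htest _ ((hφ.pd i).pd i) q
  have hA0 : ∀ᵐ t ∂ν, ∫ x, A (x, t) ∂μ = 0 := by
    filter_upwards [h.divergence_free] with t ht
    exact ht φ hφ
  have hB0 : ∀ᵐ t ∂ν, ∫ x, B (x, t) ∂μ = 0 := by
    filter_upwards [h.divergence_free, h.weak_gradient,
      memLp_slice (by norm_num) (by norm_num) hu, memLp_slice (by norm_num) (by norm_num) hG]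
      with t h1 h2 h3 h4
    exact integral_gradient_hessian_eq_zero h3 h4 h2 h1 hφ
  have hloc : LocallyIntegrableOn (fun t => ∫ x, H (x, t) ∂μ) (Ioo a b) :=
    IntegrableOn.locallyIntegrableOn hH.integral_prod_right
  have hzero : ∀ χ : ℝ → ℝ, ContDiff ℝ (⊤ : ℕ∞) χ → HasCompactSupport χ → tsupport χ ⊆ Ioo a b →
      ∫ t, χ t • ∫ x, H (x, t) ∂μ = 0 := by
    intro χ h1 h2 h3
    have hχ : IsTestFunction (Ioo a b) χ := ⟨h1, h2, h3⟩
    have hm := h.momentum _ (isTestFunction_gradientField hφ hχ)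
    have e : ∀ z : E3 × ℝ, (- (∑ i, u z i * dt (gradientField χ φ) z i) +
        (∑ i, ∑ j, G z (i, j) * dx j (gradientField χ φ) z i)
        - (∑ i, ∑ j, u z i * u z j * dx j (gradientField χ φ) z i)
        - p z * ∑ i, dx i (gradientField χ φ) z i) =
        -(deriv χ z.2 * A z) + χ z.2 * B z - χ z.2 * H z := by
      intro z
      simp_rw [dt_gradientField hφ hχ, dx_gradientField hφ hχ]
      simp only [A, B, H, Finset.mul_sum, mul_add]
      simp only [Fin.sum_univ_three]
      ring
    simp_rw [e] at hm
    have hχc : Continuous χ := h1.continuous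
    have hχ'c : Continuous (deriv χ) := h1.continuous_deriv (by simp)
    obtain ⟨c, hc⟩ := h2.exists_bound_of_continuous hχc
    obtain ⟨c', hc'⟩ := h2.deriv.exists_bound_of_continuous hχ'c
    have bdd : ∀ {F : E3 × ℝ → ℝ}, Integrable F (μ.prod ν) → ∀ {χ : ℝ → ℝ}, Continuous χ →
        ∀ {c : ℝ}, (∀ t, ‖χ t‖ ≤ c) → Integrable (fun z => χ z.2 * F z) (μ.prod ν) := by
      intro F hF χ hχ c hc
      exact hF.bdd_mul (by fun_prop) (Filter.Eventually.of_forall fun z => hc z.2)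
    have j1 := bdd hA hχ'c hc'
    have j2 := bdd hB hχc hc
    have j3 := bdd hH hχc hc
    have j12 : Integrable (fun z => -(deriv χ z.2 * A z) + χ z.2 * B z) (μ.prod ν) := j1.neg.add j2
    rw [hprod, integral_sub j12 j3,
      integral_add (f := fun z => -(deriv χ z.2 * A z)) j1.neg j2, integral_neg,
      integral_prod_symm _ j1, integral_prod_symm _ j2, integral_prod_symm _ j3] at hm
    simp only [integral_const_mul] at hm
    have z1 : ∫ t, deriv χ t * ∫ x, A (x, t) ∂μ ∂ν = 0 := by
      refine integral_eq_zero_of_ae ?_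
      filter_upwards [hA0] with t ht
      simp [ht]
    have z2 : ∫ t, χ t * ∫ x, B (x, t) ∂μ ∂ν = 0 := by
      refine integral_eq_zero_of_ae ?_
      filter_upwards [hB0] with t ht
      simp [ht]
    rw [z1, z2] at hm
    rw [← setIntegral_eq_integral_of_forall_compl_eq_zero (s := Ioo a b)]
    · simp only [smul_eq_mul]
      linarith
    · intro t ht
      have : χ t = 0 := by
        by_contra hcon
        exact ht (h3 (subset_tsupport _ hcon))
      rw [this, zero_smul]
  have := isOpen_Ioo.ae_eq_zero_of_integral_contDiff_smul_eq_zero hloc hzero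
  rw [ae_restrict_iff' measurableSet_Ioo]
  exact this

/-- Both terms are sums of convolutions with smooth compactly supported kernels. The continuity
extends the slice equation from a dense set of centres `x` to all of them. -/
theorem continuous_doubleDiv_add {W : Set E3} (hW : MeasurableSet W)
    {v : E3 → E3} {q : E3 → ℝ} (hv : MemLp v 2 (volume.restrict W)) (hq : IntegrableOn q W)
    {K : E3 → ℝ} (hK : IsTestFunction univ K) :
    Continuous fun x => doubleDiv W v (fun y => K (x - y)) +
      ∫ y in W, q y * ∑ i, pd i (pd i (fun y => K (x - y))) y := by
  have aux : ∀ (f : E3 → ℝ), IntegrableOn f W → ∀ i j,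
      Continuous fun x => ∫ y in W, f y * pd j (pd i K) (x - y) := by
    intro f hf i j
    have h := (contDiff_integral_mul_kernel
      ((integrable_indicator_iff hW).2 hf).locallyIntegrable ((hK.pd i).pd j).smooth
      ((hK.pd i).pd j).compact).continuous
    refine h.congr fun x => ?_
    rw [← integral_indicator hW]
    congr 1
    funext y
    by_cases hy : y ∈ W <;> simp [hy]
  have hb : ∀ (f : E3 → ℝ), IntegrableOn f W → ∀ i j x,
      Integrable (fun y => f y * pd j (pd i K) (x - y)) (volume.restrict W) := by
    intro f hf i j x
    obtain ⟨C, hC⟩ := ((hK.pd i).pd j).bounded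
    have hc := ((hK.pd i).pd j).smooth.continuous
    exact hf.mul_bdd (c := C) (by fun_prop) (Filter.Eventually.of_forall fun y => hC _)
  have hvv := fun i j => integrable_coord_mul_coord hv i j
  unfold doubleDiv
  simp_rw [pd_pd_comp_const_sub hK.smooth, Finset.mul_sum]
  have e1 : ∀ x, ∫ y in W, ∑ i, ∑ j, v y i * v y j * pd j (pd i K) (x - y) =
      ∑ i, ∑ j, ∫ y in W, v y i * v y j * pd j (pd i K) (x - y) := by
    intro x
    rw [integral_finsetSum _ fun i _ => integrable_finsetSum _ fun j _ => hb _ (hvv i j) i j x]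
    simp_rw [integral_finsetSum Finset.univ fun j _ => hb _ (hvv _ j) _ j x]
  have e2 : ∀ x, ∫ y in W, ∑ i, q y * pd i (pd i K) (x - y) =
      ∑ i, ∫ y in W, q y * pd i (pd i K) (x - y) := fun x =>
    integral_finsetSum _ fun i _ => hb _ hq i i x
  simp_rw [e1, e2]
  refine Continuous.add ?_ ?_
  · exact continuous_finsetSum _ fun i _ => continuous_finsetSum _ fun j _ => aux _ (hvv i j) i j
  · exact continuous_finsetSum _ fun i _ => aux _ hq i i

theorem IsSuitableWeakSolution.ae_isSlice {Ω : Set E3} {a b : ℝ} {u : E3 × ℝ → E3}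
    {G : E3 × ℝ → M3} {p : E3 × ℝ → ℝ} (h : IsSuitableWeakSolution Ω a b u G p) (hΩ : IsOpen Ω)
    {x₀ : E3} {ρ : ℝ} (hball : Metric.ball x₀ ρ ⊆ Ω) :
    ∀ᵐ t ∂(volume.restrict (Ioo a b)), IsSlice (Metric.ball x₀ ρ) (fun x => u (x, t))
      (fun x => G (x, t)) (fun x => p (x, t)) := by
  have hprod : volume.restrict (Ω ×ˢ Ioo a b) =
      (volume.restrict Ω).prod (volume.restrict (Ioo a b)) := by
    rw [Measure.prod_restrict, Measure.volume_eq_prod]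
  have hfin : IsFiniteMeasure (volume.restrict (Metric.ball x₀ ρ)) := ⟨by
    rw [Measure.restrict_apply_univ]
    exact measure_ball_lt_top⟩
  have h32 : (1 : ℝ≥0∞) ≤ 3 / 2 := by
    rw [ENNReal.le_div_iff_mul_le (by norm_num) (by norm_num)]
    norm_num
  filter_upwards [h.divergence_free, h.weak_gradient,
    memLp_slice (by norm_num) (by norm_num) (hprod ▸ h.velocity_L2),
    memLp_slice (by norm_num) (by norm_num) (hprod ▸ h.gradient_L2),
    memLp_slice (by norm_num) (by norm_num [ENNReal.div_eq_top]) (hprod ▸ h.pressure_mem)]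
    with t h1 h2 h3 h4 h5
  have hmono : volume.restrict (Metric.ball x₀ ρ) ≤ volume.restrict Ω :=
    Measure.restrict_mono hball le_rfl
  refine ⟨h3.mono_measure hmono, h4.mono_measure hmono,
    (h5.mono_measure hmono).integrable h32, fun i => ?_, fun φ hφ => ?_⟩
  · exact HasWeakPartials.mono hΩ.measurableSet hball fun φ hφ j => h2.integral_eq φ hφ i j
  · have hz : ∀ i, ∀ x ∉ Metric.ball x₀ ρ, pd i φ x = 0 := by
      intro i x hx
      by_contra hcon
      exact hx ((hφ.pd i).support_subset (subset_tsupport _ hcon))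
    rw [← h1 φ (hφ.mono hball)]
    symm
    refine setIntegral_eq_of_subset_of_forall_sdiff_eq_zero hΩ.measurableSet hball fun x hx =>
      Finset.sum_eq_zero fun i _ => ?_
    change u (x, t) i * pd i φ x = 0
    rw [hz i x hx.2, mul_zero]

/-- A single null set of times must serve all centres and scales. Countably many scales and a dense
sequence of centres give one, and continuity in `x` covers the rest. -/
theorem IsSuitableWeakSolution.ae_dyadic_pressure_equation {Ω : Set E3} {a b : ℝ}
    {u : E3 × ℝ → E3} {G : E3 × ℝ → M3} {p : E3 × ℝ → ℝ}
    (h : IsSuitableWeakSolution Ω a b u G p) (hΩ : IsOpen Ω)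
    {x₀ : E3} {ρ : ℝ} (hρ : 0 < ρ) (hball : Metric.ball x₀ ρ ⊆ Ω) {Θ : E3 → ℝ}
    (hΘ : ContDiff ℝ (⊤ : ℕ∞) Θ) (hΘs : ∀ x, 1 < ‖x‖ → Θ x = 0) :
    ∀ᵐ t ∂(volume.restrict (Ioo a b)), ∀ k : ℕ, ∀ x ∈ Metric.ball x₀ (ρ / 4),
      doubleDiv (Metric.ball x₀ ρ) (fun x => u (x, t))
        (fun y => rescale (ρ / 8 / 2 ^ k) Θ (x - y)) =
        - ∫ y in Metric.ball x₀ ρ,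
          p (y, t) * ∑ i, pd i (pd i (fun y => rescale (ρ / 8 / 2 ^ k) Θ (x - y))) y := by
  set W := Metric.ball x₀ ρ with hWdef
  have hW : MeasurableSet W := Metric.isOpen_ball.measurableSet
  have hs : ∀ k : ℕ, 0 < ρ / 8 / 2 ^ k := fun k => by positivity
  have htest : ∀ (k : ℕ), ∀ x ∈ Metric.ball x₀ (ρ / 4),
      IsTestFunction W (fun y => rescale (ρ / 8 / 2 ^ k) Θ (x - y)) := by
    intro k x hx
    refine isTestFunction_rescale hΘ hΘs (hs k) ?_
    refine Metric.closedBall_subset_ball' ?_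
    have h1 := Metric.mem_ball.1 hx
    have h2 : ρ / 8 / 2 ^ k ≤ ρ / 8 := div_le_self (by positivity) (one_le_pow₀ (by norm_num))
    linarith
  have hK : ∀ k : ℕ, IsTestFunction univ (rescale (ρ / 8 / 2 ^ k) Θ) := fun k =>
    ⟨contDiff_rescale hΘ _, HasCompactSupport.intro (isCompact_closedBall 0 (ρ / 8 / 2 ^ k))
      fun x hx => rescale_eq_zero hΘs (hs k) (by simpa using hx), subset_univ _⟩
  have hae : ∀ᵐ t ∂(volume.restrict (Ioo a b)), ∀ k n : ℕ,
      TopologicalSpace.denseSeq E3 n ∈ Metric.ball x₀ (ρ / 4) →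
      ∫ y in Ω, ((∑ i, ∑ j, u (y, t) i * u (y, t) j *
        pd j (pd i (fun y => rescale (ρ / 8 / 2 ^ k) Θ (TopologicalSpace.denseSeq E3 n - y))) y) +
        p (y, t) * ∑ i, pd i (pd i
          (fun y => rescale (ρ / 8 / 2 ^ k) Θ (TopologicalSpace.denseSeq E3 n - y))) y) = 0 := by
    rw [ae_all_iff]
    intro k
    rw [ae_all_iff]
    intro n
    by_cases hn : TopologicalSpace.denseSeq E3 n ∈ Metric.ball x₀ (ρ / 4)
    · filter_upwards [h.ae_pressure_equation ((htest k _ hn).mono hball)] with t ht _ using ht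
    · exact Filter.Eventually.of_forall fun t ht => absurd ht hn
  filter_upwards [hae, h.ae_isSlice hΩ hball] with t ht hsl k x hx
  rw [eq_neg_iff_add_eq_zero]
  set E : E3 → ℝ := fun x => doubleDiv W (fun x => u (x, t))
    (fun y => rescale (ρ / 8 / 2 ^ k) Θ (x - y)) +
    ∫ y in W, p (y, t) * ∑ i, pd i (pd i (fun y => rescale (ρ / 8 / 2 ^ k) Θ (x - y))) y with hE
  have hEc : Continuous E := continuous_doubleDiv_add hW hsl.velocity_memLp
    hsl.pressure_integrable (hK k)
  have hclosed : IsClosed {x | E x = 0} := isClosed_eq hEc continuous_const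
  have hsub : Metric.ball x₀ (ρ / 4) ∩ range (TopologicalSpace.denseSeq E3) ⊆ {x | E x = 0} := by
    rintro _ ⟨hy, n, rfl⟩
    set w := TopologicalSpace.denseSeq E3 n
    have hφ := htest k w hy
    set φ := fun y => rescale (ρ / 8 / 2 ^ k) Θ (w - y)
    have h0 := ht k n hy
    have hz : ∀ i j, ∀ x ∉ W, pd j (pd i φ) x = 0 := by
      intro i j x hx
      by_contra hcon
      exact hx (((hφ.pd i).pd j).support_subset (subset_tsupport _ hcon))
    have hr : ∫ y in Ω, ((∑ i, ∑ j, u (y, t) i * u (y, t) j * pd j (pd i φ) y) +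
        p (y, t) * ∑ i, pd i (pd i φ) y) = ∫ y in W, ((∑ i, ∑ j, u (y, t) i * u (y, t) j *
        pd j (pd i φ) y) + p (y, t) * ∑ i, pd i (pd i φ) y) := by
      refine setIntegral_eq_of_subset_of_forall_sdiff_eq_zero hΩ.measurableSet hball fun x hx => ?_
      simp [hz _ _ x hx.2]
    rw [hr, integral_add] at h0
    · exact h0
    · exact integrable_finsetSum _ fun i _ => integrable_finsetSum _ fun j _ =>
        ((hφ.pd i).pd j).integrable_mul (integrable_coord_mul_coord hsl.velocity_memLp i j)
    · simp_rw [Finset.mul_sum]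
      exact integrable_finsetSum _ fun i _ =>
        ((hφ.pd i).pd i).integrable_mul hsl.pressure_integrable
  exact hclosed.closure_subset_iff.2 hsub
    ((TopologicalSpace.denseRange_denseSeq E3).open_subset_closure_inter Metric.isOpen_ball hx)

end NavierStokes

/-! ### Integration in time and the final power count. -/

namespace NavierStokes

/-- Hölder with exponents 4 and 4/3 on an interval of length `r²`. -/
theorem setLIntegral_rpow_three_quarters_le {t r : ℝ} (hr : 0 < r) {f : ℝ → ℝ≥0∞}
    (hf : AEMeasurable f (volume.restrict (Ioo (t - r ^ 2) t))) :
    ∫⁻ s in Ioo (t - r ^ 2) t, f s ^ (3 / 4 : ℝ) ≤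
      ENNReal.ofReal (r ^ (1 / 2 : ℝ)) * (∫⁻ s in Ioo (t - r ^ 2) t, f s) ^ (3 / 4 : ℝ) := by
  have h := ENNReal.lintegral_mul_norm_pow_le (μ := volume.restrict (Ioo (t - r ^ 2) t))
    (f := fun _ => 1) aemeasurable_const hf (p := 1 / 4) (q := 3 / 4) (by norm_num) (by norm_num)
    (by norm_num)
  simp only [ENNReal.one_rpow, one_mul, lintegral_one, Measure.restrict_apply_univ,
    Real.volume_Ioo, sub_sub_cancel] at h
  rw [ENNReal.ofReal_rpow_of_nonneg (by positivity) (by norm_num), ← Real.rpow_natCast,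
    ← Real.rpow_mul hr.le] at h
  norm_num at h ⊢
  exact h

/-- Convexity of the power 3/2. Writing `y^{3/2}` as `(y²)^{3/4}` matches the integrand of
`scaledD`. -/
theorem rpow_three_halves_add_le {N C x y κ : ℝ≥0∞} (h : N ≤ C * (x ^ (1 / 2 : ℝ) + κ * y)) :
    N ^ (3 / 2 : ℝ) ≤ C ^ (3 / 2 : ℝ) * 2 ^ (1 / 2 : ℝ) *
      (x ^ (3 / 4 : ℝ) + κ ^ (3 / 2 : ℝ) * (y ^ 2) ^ (3 / 4 : ℝ)) := by
  refine (ENNReal.rpow_le_rpow h (by norm_num)).trans ?_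
  rw [ENNReal.mul_rpow_of_nonneg _ _ (by norm_num), mul_assoc]
  refine mul_le_mul_right ?_ _
  refine (ENNReal.rpow_add_le_mul_rpow_add_rpow _ _ (by norm_num)).trans (le_of_eq ?_)
  rw [ENNReal.mul_rpow_of_nonneg _ _ (by norm_num), ← ENNReal.rpow_mul, ← ENNReal.rpow_natCast,
    ← ENNReal.rpow_mul]
  norm_num

theorem ofReal_mul_ofReal_inv_mul {c : ℝ} (hc : 0 < c) (x : ℝ≥0∞) :
    ENNReal.ofReal c * (ENNReal.ofReal c⁻¹ * x) = x := by
  rw [← mul_assoc, ← ENNReal.ofReal_mul hc.le, mul_inv_cancel₀ hc.ne', ENNReal.ofReal_one, one_mul]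

section Slices

variable {x₀ : E3} {ρ : ℝ} {J : Set ℝ}

theorem aemeasurable_setLIntegral_slice {f : E3 × ℝ → ℝ≥0∞}
    (hf : AEMeasurable f (volume.restrict (Metric.ball x₀ ρ ×ˢ J))) :
    AEMeasurable (fun t => ∫⁻ x in Metric.ball x₀ ρ, f (x, t)) (volume.restrict J) := by
  rw [Measure.volume_eq_prod, ← Measure.prod_restrict] at hf
  exact hf.lintegral_prod_left'

theorem setLIntegral_slice {f : E3 × ℝ → ℝ≥0∞}
    (hf : AEMeasurable f (volume.restrict (Metric.ball x₀ ρ ×ˢ J))) :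
    ∫⁻ t in J, ∫⁻ x in Metric.ball x₀ ρ, f (x, t) = ∫⁻ z in Metric.ball x₀ ρ ×ˢ J, f z := by
  rw [Measure.volume_eq_prod, ← Measure.prod_restrict] at hf ⊢
  rw [lintegral_prod_symm _ hf]

end Slices

/-- Power counting: `r^{-2+1/2} ρ^{3/4+3/4}` in the first term and `r^{-2+3+1/2} ρ^{-15/4+9/4}` in
the second. -/
theorem scaled_coefficients {ρ r : ℝ} (hρ : 0 < ρ) (hr : 0 < r) (A B D : ℝ≥0∞) :
    ENNReal.ofReal (r⁻¹ ^ 2) * ((ENNReal.ofReal ρ * A) ^ (3 / 4 : ℝ) *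
        (ENNReal.ofReal (r ^ (1 / 2 : ℝ)) * (ENNReal.ofReal ρ * B) ^ (3 / 4 : ℝ)) +
      ENNReal.ofReal (r ^ 2 * ρ ^ (-(5 / 2) : ℝ)) ^ (3 / 2 : ℝ) *
        (ENNReal.ofReal (r ^ (1 / 2 : ℝ)) * (ENNReal.ofReal (ρ ^ 3) * D) ^ (3 / 4 : ℝ))) =
    ENNReal.ofReal ((ρ / r) ^ (3 / 2 : ℝ)) * A ^ (3 / 4 : ℝ) * B ^ (3 / 4 : ℝ) +
      ENNReal.ofReal ((r / ρ) ^ (3 / 2 : ℝ)) * D ^ (3 / 4 : ℝ) := by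
  have h34 : (0 : ℝ) ≤ 3 / 4 := by norm_num
  have r2 : r⁻¹ ^ 2 = r ^ (-2 : ℝ) := by
    rw [Real.rpow_neg hr.le, inv_pow]
    norm_cast
  have e1 : r⁻¹ ^ 2 * ρ ^ (3 / 4 : ℝ) * r ^ (1 / 2 : ℝ) * ρ ^ (3 / 4 : ℝ) =
      (ρ / r) ^ (3 / 2 : ℝ) := by
    rw [Real.div_rpow hρ.le hr.le, r2, div_eq_mul_inv (ρ ^ (3 / 2 : ℝ)) (r ^ (3 / 2 : ℝ)),
      ← Real.rpow_neg hr.le]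
    calc _ = (ρ ^ (3 / 4 : ℝ) * ρ ^ (3 / 4 : ℝ)) * (r ^ (-2 : ℝ) * r ^ (1 / 2 : ℝ)) := by ring
      _ = _ := by
        rw [← Real.rpow_add hρ, ← Real.rpow_add hr]
        norm_num
  have e2 : r⁻¹ ^ 2 * (r ^ 2 * ρ ^ (-(5 / 2) : ℝ)) ^ (3 / 2 : ℝ) * r ^ (1 / 2 : ℝ) *
      (ρ ^ 3) ^ (3 / 4 : ℝ) = (r / ρ) ^ (3 / 2 : ℝ) := by
    rw [Real.div_rpow hr.le hρ.le, r2, div_eq_mul_inv (r ^ (3 / 2 : ℝ)) (ρ ^ (3 / 2 : ℝ)),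
      ← Real.rpow_neg hρ.le,
      Real.mul_rpow (by positivity) (by positivity), ← Real.rpow_mul hρ.le,
      ← Real.rpow_natCast r 2, ← Real.rpow_natCast ρ 3, ← Real.rpow_mul hr.le, ← Real.rpow_mul hρ.le]
    calc _ = (r ^ (-2 : ℝ) * r ^ (((2 : ℕ) : ℝ) * (3 / 2)) * r ^ (1 / 2 : ℝ)) *
        (ρ ^ (-(5 / 2) * (3 / 2) : ℝ) * ρ ^ (((3 : ℕ) : ℝ) * (3 / 4))) := by ring
      _ = _ := by
        rw [← Real.rpow_add hρ, ← Real.rpow_add hr, ← Real.rpow_add hr]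
        norm_num
  rw [← e1, ← e2]
  simp_rw [ENNReal.mul_rpow_of_nonneg _ _ h34]
  rw [ENNReal.ofReal_rpow_of_nonneg hρ.le h34, ENNReal.ofReal_rpow_of_nonneg (by positivity) h34,
    ENNReal.ofReal_rpow_of_nonneg (by positivity) (by norm_num)]
  rw [ENNReal.ofReal_mul (by positivity), ENNReal.ofReal_mul (by positivity),
    ENNReal.ofReal_mul (by positivity), ENNReal.ofReal_mul (by positivity),
    ENNReal.ofReal_mul (by positivity), ENNReal.ofReal_mul (by positivity)]
  ring

end NavierStokes

open NavierStokes in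
theorem lemma3p4 :
    ∃ C : ℝ, 0 < C ∧
      ∀ (Ω : Set NavierStokes.E3) (a b : ℝ), IsOpen Ω → a < b →
      ∀ (u : NavierStokes.E3 × ℝ → NavierStokes.E3) (G : NavierStokes.E3 × ℝ → NavierStokes.M3)
        (p : NavierStokes.E3 × ℝ → ℝ),
        NavierStokes.IsSuitableWeakSolution Ω a b u G p →
      ∀ (z₀ : NavierStokes.E3 × ℝ) (ρ : ℝ), 0 < ρ →
        NavierStokes.cylinder z₀ ρ ⊆ Ω ×ˢ Ioo a b →
      ∀ r : ℝ, 0 < r → r ≤ ρ / 4 →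
        NavierStokes.scaledD₁ p z₀ r ≤
          ENNReal.ofReal (C * (ρ / r) ^ (3 / 2 : ℝ))
              * NavierStokes.scaledA u z₀ ρ ^ (3 / 4 : ℝ)
              * NavierStokes.scaledB G z₀ ρ ^ (3 / 4 : ℝ)
            + ENNReal.ofReal (C * (r / ρ) ^ (3 / 2 : ℝ))
              * NavierStokes.scaledD p z₀ ρ ^ (3 / 4 : ℝ) := by
  obtain ⟨Θ, hΘ, hΘs, C, hC, hslice⟩ := exists_slice_estimate
  set C' : ℝ≥0∞ := C ^ (3 / 2 : ℝ) * 2 ^ (1 / 2 : ℝ)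
  have hC' : C' ≠ ⊤ := ENNReal.mul_ne_top (ENNReal.rpow_ne_top_of_nonneg (by norm_num) hC)
    (ENNReal.rpow_ne_top_of_nonneg (by norm_num) (by norm_num))
  -- Adding 1 ensures positivity without a lower bound on `C'`.
  refine ⟨C'.toReal + 1, by positivity, ?_⟩
  rintro Ω a b hΩ - u G p h ⟨x₀, t₀⟩ ρ hρ hcyl r hr hrρ
  have hρ2 : 0 < ρ ^ 2 := by positivity
  obtain ⟨hball, hJ⟩ : Metric.ball x₀ ρ ⊆ Ω ∧ Ioo (t₀ - ρ ^ 2) t₀ ⊆ Ioo a b := by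
    rcases prod_subset_prod_iff.1 hcyl with h1 | h1 | h1
    · exact h1
    · exact absurd h1 (Metric.nonempty_ball.2 hρ).ne_empty
    · exact absurd h1 (nonempty_Ioo.2 (by simp [hρ2])).ne_empty
  have hrρ2 : r ^ 2 ≤ ρ ^ 2 := pow_le_pow_left₀ hr.le (by linarith) 2
  have hIJ : Ioo (t₀ - r ^ 2) t₀ ⊆ Ioo (t₀ - ρ ^ 2) t₀ := Ioo_subset_Ioo_left (by linarith)
  set I := Ioo (t₀ - r ^ 2) t₀ with hI
  set J := Ioo (t₀ - ρ ^ 2) t₀ with hJdef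
  set W := Metric.ball x₀ ρ with hW
  set A := scaledA u (x₀, t₀) ρ
  set B := scaledB G (x₀, t₀) ρ with hBdef
  set D := scaledD p (x₀, t₀) ρ with hDdef
  have hQ : volume.restrict (W ×ˢ J) ≤ volume.restrict (Ω ×ˢ Ioo a b) :=
    Measure.restrict_mono (prod_mono hball hJ) le_rfl
  have hGm : AEMeasurable (fun z => ‖G z‖ₑ ^ 2) (volume.restrict (W ×ˢ J)) :=
    (h.gradient_L2.1.mono_measure hQ).enorm.pow_const 2
  have hpm : AEMeasurable (fun z => ‖p z‖ₑ ^ (6 / 5 : ℝ)) (volume.restrict (W ×ˢ J)) :=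
    (h.pressure_mem.1.mono_measure hQ).enorm.pow_const _
  let g2 : ℝ → ℝ≥0∞ := fun t => ∫⁻ x in W, ‖G (x, t)‖ₑ ^ 2
  let d : ℝ → ℝ≥0∞ := fun t => eLpNorm (fun x => p (x, t)) (6 / 5) (volume.restrict W)
  have hg2m : AEMeasurable g2 (volume.restrict I) :=
    (aemeasurable_setLIntegral_slice hGm).mono_measure (Measure.restrict_mono hIJ le_rfl)
  have hdm : AEMeasurable (fun t => d t ^ 2) (volume.restrict I) := by
    have h1 := ((aemeasurable_setLIntegral_slice hpm).mono_measure
      (Measure.restrict_mono hIJ le_rfl)).pow_const (1 / (6 / 5 : ℝ))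
    refine AEMeasurable.pow_const ?_ 2
    convert h1 using 1
    funext t
    simp only [d]
    rw [eLpNorm_eq_lintegral_rpow_enorm_toReal (by norm_num) (by norm_num [ENNReal.div_eq_top])]
    simp
    rfl
  have hBint : ∫⁻ t in I, g2 t ≤ ENNReal.ofReal ρ * B := by
    refine (lintegral_mono_set hIJ).trans (le_of_eq ?_)
    rw [hBdef, scaledB, ofReal_mul_ofReal_inv_mul hρ]
    exact setLIntegral_slice hGm
  have hDint : ∫⁻ t in I, d t ^ 2 ≤ ENNReal.ofReal (ρ ^ 3) * D := by
    refine (lintegral_mono_set hIJ).trans (le_of_eq ?_)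
    rw [hDdef, scaledD, inv_pow, ofReal_mul_ofReal_inv_mul (by positivity)]
  have hAle : ∀ᵐ t ∂(volume.restrict I), ∫⁻ x in W, ‖u (x, t)‖ₑ ^ 2 ≤ ENNReal.ofReal ρ * A := by
    have h1 := ENNReal.ae_le_essSup (μ := volume.restrict (Icc (t₀ - ρ ^ 2) t₀))
      fun t : ℝ => ENNReal.ofReal ρ⁻¹ * ∫⁻ x in W, ‖u (x, t)‖ₑ ^ 2
    filter_upwards [ae_restrict_of_ae_restrict_of_subset (hIJ.trans Ioo_subset_Icc_self) h1]
      with t ht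
    rw [← ofReal_mul_ofReal_inv_mul hρ (∫⁻ x in W, ‖u (x, t)‖ₑ ^ 2)]
    exact mul_le_mul_right ht _
  set κ := ENNReal.ofReal (r ^ 2 * ρ ^ (-(5 / 2) : ℝ))
  -- The kinetic factor is replaced by its essential supremum in time, so only `g2` and `d` still
  -- depend on `t`.
  have hpt : ∀ᵐ t ∂(volume.restrict I),
      eLpNorm (fun x => p (x, t)) (3 / 2) (volume.restrict (Metric.ball x₀ r)) ^ (3 / 2 : ℝ) ≤
        C' * ((ENNReal.ofReal ρ * A) ^ (3 / 4 : ℝ) * g2 t ^ (3 / 4 : ℝ) +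
          κ ^ (3 / 2 : ℝ) * (d t ^ 2) ^ (3 / 4 : ℝ)) := by
    filter_upwards [hAle, ae_restrict_of_ae_restrict_of_subset (hIJ.trans hJ)
      (h.ae_isSlice hΩ hball), ae_restrict_of_ae_restrict_of_subset (hIJ.trans hJ)
      (h.ae_dyadic_pressure_equation hΩ hρ hball hΘ hΘs)] with t h1 h2 h3
    refine (rpow_three_halves_add_le (hslice x₀ ρ hρ _ _ _ h2 h3 r hr hrρ)).trans ?_
    rw [ENNReal.mul_rpow_of_nonneg _ _ (by norm_num)]
    gcongr
  calc scaledD₁ p (x₀, t₀) r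
      ≤ ENNReal.ofReal (r⁻¹ ^ 2) * ∫⁻ t in I,
          C' * ((ENNReal.ofReal ρ * A) ^ (3 / 4 : ℝ) * g2 t ^ (3 / 4 : ℝ) +
          κ ^ (3 / 2 : ℝ) * (d t ^ 2) ^ (3 / 4 : ℝ)) :=
        mul_le_mul_right (lintegral_mono_ae hpt) _
    _ = ENNReal.ofReal (r⁻¹ ^ 2) * (C' * ((∫⁻ t in I,
          (ENNReal.ofReal ρ * A) ^ (3 / 4 : ℝ) * g2 t ^ (3 / 4 : ℝ)) +
          ∫⁻ t in I, κ ^ (3 / 2 : ℝ) * (d t ^ 2) ^ (3 / 4 : ℝ))) := by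
        rw [lintegral_const_mul' _ _ hC',
          lintegral_add_left' ((hg2m.pow_const _).const_mul _)]
    _ ≤ ENNReal.ofReal (r⁻¹ ^ 2) * (C' * ((ENNReal.ofReal ρ * A) ^ (3 / 4 : ℝ) *
          (ENNReal.ofReal (r ^ (1 / 2 : ℝ)) * (ENNReal.ofReal ρ * B) ^ (3 / 4 : ℝ)) +
          κ ^ (3 / 2 : ℝ) * (ENNReal.ofReal (r ^ (1 / 2 : ℝ)) *
            (ENNReal.ofReal (ρ ^ 3) * D) ^ (3 / 4 : ℝ)))) := by
        -- The factor with `A` is not known to be finite here, so measurability of the integrand is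
        -- what allows it to be pulled out.
        rw [lintegral_const_mul'' _ (hg2m.pow_const _), lintegral_const_mul'' _ (hdm.pow_const _)]
        gcongr
        · exact (setLIntegral_rpow_three_quarters_le hr hg2m).trans (by gcongr)
        · exact (setLIntegral_rpow_three_quarters_le hr hdm).trans (by gcongr)
    _ = C' * (ENNReal.ofReal ((ρ / r) ^ (3 / 2 : ℝ)) * A ^ (3 / 4 : ℝ) * B ^ (3 / 4 : ℝ) +
          ENNReal.ofReal ((r / ρ) ^ (3 / 2 : ℝ)) * D ^ (3 / 4 : ℝ)) := by
        rw [mul_left_comm, scaled_coefficients hρ hr]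
    _ ≤ ENNReal.ofReal (C'.toReal + 1) * (ENNReal.ofReal ((ρ / r) ^ (3 / 2 : ℝ)) *
          A ^ (3 / 4 : ℝ) * B ^ (3 / 4 : ℝ) +
          ENNReal.ofReal ((r / ρ) ^ (3 / 2 : ℝ)) * D ^ (3 / 4 : ℝ)) := by
        refine mul_le_mul_left ?_ _
        rw [← ENNReal.ofReal_toReal hC']
        exact ENNReal.ofReal_le_ofReal (by simp)
    _ = _ := by
        rw [ENNReal.ofReal_mul (by positivity), ENNReal.ofReal_mul (by positivity)]
        ring
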